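/- Work in the Euclidean plane. One can travel everywhere at speed $1$; a highway is a straight line $\ell$ of arbitrary orientation along which travel takes no time (infinite speed), and which can be entered and left at every point. The travel time between $p$ and $q$ in the presence of $\ell$ is the infimum of the times of all polygonal routes from $p$ to $q$. For a finite nonempty set $S$ of points, the travel-time diameter of $S$ with respect to $\ell$ is the maximum travel time over all pairs of points of $S$, and $\ell$ is an optimal highway for $S$ if no line has a smaller travel-time diameter. A strip is the closed region between two parallel lines (possibly coinciding, so that width $0$ is allowed), and a smallest enclosing strip of $S$ is a strip of any orientation that contains $S$ and has minimum width among all such strips. Theorem. (1) Every finite nonempty set $S$ of points in the plane has a smallest enclosing strip, and the middle line of every smallest enclosing strip of $S$ is an optimal highway for $S$. (2) There is a real-RAM program (exact unit-cost real arithmetic $+,-,\times,\div$ and comparisons; integers of $O(\log n)$ bits for counting and addressing) that, given the coordinates of $n\ge 2$ distinct points forming a set $S$, computes in $O(n\log n)$ steps the coefficients $(a,b,c)$ of a line $ax+by=c$ that is the middle line of a smallest enclosing strip of $S$, and hence an optimal highway for $S$. More precisely, the program consists of two consecutive parts. The first part computes, in $O(n\log n)$ steps, the vertices of the convex hull of $S$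 in counterclockwise order. The second part computes, from any such list of the $h$ hull vertices, the middle line of a smallest enclosing strip of $S$ in $O(h)$ steps. -/

import Mathlib

/-! # Geometry of a single highway of infinite speed -/

/-- The Euclidean plane. -/
abbrev Plane : Type := EuclideanSpace ℝ (Fin 2)

/-- An affine subspace of the plane is a straight line. -/
def IsLine (L : AffineSubspace ℝ Plane) : Prop :=
  Module.finrank ℝ L.direction = 1

/-- The solution set of the equation `⟪u, x⟫ = c`; it is a line when `u ≠ 0`. -/
def lineOfEq (u : Plane) (c : ℝ) : AffineSubspace ℝ Plane where
  carrier := {x | inner ℝ u x = c}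
  smul_vsub_vadd_mem' := by
    intro t x y z hx hy hz
    simp only [Set.mem_ofPred_eq, vsub_eq_sub, vadd_eq_add, inner_add_right, inner_smul_right,
      inner_sub_right] at *
    rw [hx, hy, hz]
    ring

open Classical in
/-- Time needed for the straight leg from `x` to `y`: it is free when it runs along the highway `L`
(both endpoints on the line `L`), and otherwise it is travelled at speed `1`. -/
noncomputable def legTime (L : AffineSubspace ℝ Plane) (x y : Plane) : ℝ :=
  if x ∈ L ∧ y ∈ L then 0 else dist x y

/-- Total time of the polygonal route that starts at `p`, visits the listed points in order and
ends at `q`. -/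
noncomputable def routeTime (L : AffineSubspace ℝ Plane) (p : Plane) : List Plane → Plane → ℝ
  | [], q => legTime L p q
  | x :: l, q => legTime L p x + routeTime L x l q

/-- Travel time from `p` to `q` in the presence of the highway `L` of infinite speed: the infimum
over all polygonal routes. -/
noncomputable def travelTime (L : AffineSubspace ℝ Plane) (p q : Plane) : ℝ :=
  ⨅ l : List Plane, routeTime L p l q

/-- The maximum travel time over all pairs of points of `S` (a finite nonempty set). -/
noncomputable def travelTimeDiameter (L : AffineSubspace ℝ Plane) (S : Set Plane) : ℝ :=
  sSup {t | ∃ p ∈ S, ∃ q ∈ S, t = travelTime L p q}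

/-- `L` is an optimal highway (of infinite speed, arbitrary orientation) for `S`. -/
def IsOptimalHighway (S : Set Plane) (L : AffineSubspace ℝ Plane) : Prop :=
  IsLine L ∧ ∀ L' : AffineSubspace ℝ Plane, IsLine L' →
    travelTimeDiameter L S ≤ travelTimeDiameter L' S

/-- A closed strip, bounded by the two parallel lines `⟪normal, x⟫ = lo` and `⟪normal, x⟫ = hi`.
Strips of width `0` are single lines. -/
structure Strip where
  normal : Plane
  lo : ℝ
  hi : ℝ
  norm_normal : ‖normal‖ = 1
  lo_le_hi : lo ≤ hi

namespace Strip

/-- The points of the strip. -/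
def region (T : Strip) : Set Plane :=
  {x | T.lo ≤ inner ℝ T.normal x ∧ inner ℝ T.normal x ≤ T.hi}

/-- The distance of the two bounding lines. -/
def width (T : Strip) : ℝ := T.hi - T.lo

/-- The middle line of the strip. -/
noncomputable def midline (T : Strip) : AffineSubspace ℝ Plane :=
  lineOfEq T.normal ((T.lo + T.hi) / 2)

/-- `T` encloses `S`, and no strip of any orientation that encloses `S` is narrower. -/
def IsSmallestEnclosing (T : Strip) (S : Set Plane) : Prop :=
  S ⊆ T.region ∧ ∀ T' : Strip, S ⊆ T'.region → T.width ≤ T'.width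

end Strip

/-- Twice the signed area of the triangle `p q r`, positive when it is counterclockwise. -/
def orient (p q r : Plane) : ℝ :=
  (q 0 - p 0) * (r 1 - p 1) - (q 1 - p 1) * (r 0 - p 0)

/-- `v` lists each vertex of the convex hull of `S` once, in counterclockwise order. -/
def IsConvexHullCycle {h : ℕ} (v : Fin h → Plane) (S : Set Plane) : Prop :=
  Function.Injective v ∧ Set.range v = (convexHull ℝ S).extremePoints ℝ ∧
    ∀ i j k : Fin h, i < j → j < k → 0 < orient (v i) (v j) (v k)

/-! # The real RAM

Programs are finite texts of a structured imperative language with integer registers, real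
registers, integer arrays and real arrays.  Real numbers are added, subtracted, multiplied, divided
and compared exactly in unit time.  Integers serve for counting and addressing; every integer that a
program computes or reads has to fit into a machine word, that is, it may not exceed the word
bound `W`. -/

namespace RealRAM

/-- The contents of the integer and real registers and of the integer and real arrays. -/
structure State where
  ireg : ℕ → ℕ
  rreg : ℕ → ℝ
  iarr : ℕ → ℕ → ℕ
  rarr : ℕ → ℕ → ℝ

/-- Integer expressions. Subtraction is truncated at `0`. -/
inductive IExpr where
  | const (k : ℕ)
  | reg (x : ℕ)
  | get (A : ℕ) (i : IExpr)
  | add (a b : IExpr)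
  | sub (a b : IExpr)

namespace IExpr

def eval (s : State) : IExpr → ℕ
  | const k => k
  | reg x => s.ireg x
  | get A i => s.iarr A (i.eval s)
  | add a b => a.eval s + b.eval s
  | sub a b => a.eval s - b.eval s

/-- All values that occur in the evaluation fit into machine words. -/
def Ok (W : ℕ) (s : State) : IExpr → Prop
  | const k => k ≤ W
  | reg x => s.ireg x ≤ W
  | get A i => i.Ok W s ∧ s.iarr A (i.eval s) ≤ W
  | add a b => a.Ok W s ∧ b.Ok W s ∧ a.eval s + b.eval s ≤ W
  | sub a b => a.Ok W s ∧ b.Ok W s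

/-- Number of operations. -/
def cost : IExpr → ℕ
  | const _ => 1
  | reg _ => 1
  | get _ i => i.cost + 1
  | add a b => a.cost + b.cost + 1
  | sub a b => a.cost + b.cost + 1

end IExpr

/-- Real expressions; the only constants are integers. -/
inductive RExpr where
  | const (k : ℤ)
  | reg (x : ℕ)
  | get (A : ℕ) (i : IExpr)
  | add (a b : RExpr)
  | sub (a b : RExpr)
  | mul (a b : RExpr)
  | div (a b : RExpr)

namespace RExpr

noncomputable def eval (s : State) : RExpr → ℝ
  | const k => (k : ℝ)
  | reg x => s.rreg x
  | get A i => s.rarr A (i.eval s)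
  | add a b => a.eval s + b.eval s
  | sub a b => a.eval s - b.eval s
  | mul a b => a.eval s * b.eval s
  | div a b => a.eval s / b.eval s

/-- All addresses fit into machine words, and there is no division by zero. -/
def Ok (W : ℕ) (s : State) : RExpr → Prop
  | const _ => True
  | reg _ => True
  | get _ i => i.Ok W s
  | add a b => a.Ok W s ∧ b.Ok W s
  | sub a b => a.Ok W s ∧ b.Ok W s
  | mul a b => a.Ok W s ∧ b.Ok W s
  | div a b => a.Ok W s ∧ b.Ok W s ∧ b.eval s ≠ 0

/-- Number of operations. -/
def cost : RExpr → ℕ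
  | const _ => 1
  | reg _ => 1
  | get _ i => i.cost + 1
  | add a b => a.cost + b.cost + 1
  | sub a b => a.cost + b.cost + 1
  | mul a b => a.cost + b.cost + 1
  | div a b => a.cost + b.cost + 1

end RExpr

/-- Tests. -/
inductive Test where
  | ilt (a b : IExpr)
  | rlt (a b : RExpr)
  | not (a : Test)
  | and (a b : Test)

namespace Test

def eval (s : State) : Test → Prop
  | ilt a b => a.eval s < b.eval s
  | rlt a b => a.eval s < b.eval s
  | not a => ¬ a.eval s
  | and a b => a.eval s ∧ b.eval s

/-- The evaluation does not fail; the second part of a conjunction is evaluated only when the first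
part holds. -/
def Ok (W : ℕ) (s : State) : Test → Prop
  | ilt a b => a.Ok W s ∧ b.Ok W s
  | rlt a b => a.Ok W s ∧ b.Ok W s
  | not a => a.Ok W s
  | and a b => a.Ok W s ∧ (a.eval s → b.Ok W s)

/-- Number of operations (a conjunction is charged for both parts). -/
def cost : Test → ℕ
  | ilt a b => a.cost + b.cost + 1
  | rlt a b => a.cost + b.cost + 1
  | not a => a.cost + 1
  | and a b => a.cost + b.cost + 1

end Test

/-- Programs. -/
inductive Prog where
  | skip
  | iset (x : ℕ) (e : IExpr)
  | rset (x : ℕ) (e : RExpr)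
  | iput (A : ℕ) (i e : IExpr)
  | rput (A : ℕ) (i : IExpr) (e : RExpr)
  | seq (P Q : Prog)
  | ite (b : Test) (P Q : Prog)
  | loop (b : Test) (P : Prog)

/-- `Exec W P s s' t`: with word bound `W`, the program `P` started in the state `s` halts after `t`
steps in the state `s'`. -/
inductive Exec (W : ℕ) : Prog → State → State → ℕ → Prop where
  | skip (s : State) : Exec W Prog.skip s s 1
  | iset (s : State) (x : ℕ) (e : IExpr) (he : e.Ok W s) :
      Exec W (Prog.iset x e) s
        { s with ireg := Function.update s.ireg x (e.eval s) } (e.cost + 1)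
  | rset (s : State) (x : ℕ) (e : RExpr) (he : e.Ok W s) :
      Exec W (Prog.rset x e) s
        { s with rreg := Function.update s.rreg x (e.eval s) } (e.cost + 1)
  | iput (s : State) (A : ℕ) (i e : IExpr) (hi : i.Ok W s) (he : e.Ok W s) :
      Exec W (Prog.iput A i e) s
        { s with
          iarr := Function.update s.iarr A (Function.update (s.iarr A) (i.eval s) (e.eval s)) }
        (i.cost + e.cost + 1)
  | rput (s : State) (A : ℕ) (i : IExpr) (e : RExpr) (hi : i.Ok W s) (he : e.Ok W s) :
      Exec W (Prog.rput A i e) s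
        { s with
          rarr := Function.update s.rarr A (Function.update (s.rarr A) (i.eval s) (e.eval s)) }
        (i.cost + e.cost + 1)
  | seq {P Q : Prog} {s₁ s₂ s₃ : State} {t₁ t₂ : ℕ} (hP : Exec W P s₁ s₂ t₁)
      (hQ : Exec W Q s₂ s₃ t₂) : Exec W (Prog.seq P Q) s₁ s₃ (t₁ + t₂)
  | ite_true {b : Test} {P Q : Prog} {s₁ s₂ : State} {t : ℕ} (hb : b.Ok W s₁) (h : b.eval s₁)
      (hP : Exec W P s₁ s₂ t) : Exec W (Prog.ite b P Q) s₁ s₂ (b.cost + t)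
  | ite_false {b : Test} {P Q : Prog} {s₁ s₂ : State} {t : ℕ} (hb : b.Ok W s₁) (h : ¬ b.eval s₁)
      (hQ : Exec W Q s₁ s₂ t) : Exec W (Prog.ite b P Q) s₁ s₂ (b.cost + t)
  | loop_true {b : Test} {P : Prog} {s₁ s₂ s₃ : State} {t₁ t₂ : ℕ} (hb : b.Ok W s₁)
      (h : b.eval s₁) (hP : Exec W P s₁ s₂ t₁) (hL : Exec W (Prog.loop b P) s₂ s₃ t₂) :
      Exec W (Prog.loop b P) s₁ s₃ (b.cost + t₁ + t₂)
  | loop_false {b : Test} {P : Prog} {s : State} (hb : b.Ok W s) (h : ¬ b.eval s) :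
      Exec W (Prog.loop b P) s s b.cost

/-- The list `p` of points is stored in the state: integer register `0` holds their number, and the
real arrays `0` and `1` hold their coordinates. All other contents are arbitrary. -/
def State.Holds (s : State) {n : ℕ} (p : Fin n → Plane) : Prop :=
  s.ireg 0 = n ∧ ∀ i : Fin n, s.rarr 0 i = p i 0 ∧ s.rarr 1 i = p i 1

/-- The line `a x + b y = c` whose coefficients `a`, `b`, `c` are in the real registers
`0`, `1`, `2`. -/
noncomputable def State.outputLine (s : State) : AffineSubspace ℝ Plane :=
  lineOfEq !₂[s.rreg 0, s.rreg 1] (s.rreg 2)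

end RealRAM

/-! # Travel times and enclosing strips -/

/-! Fix a line with unit normal `u`. A leg along it does not change `⟪u, ·⟫`, and any other leg
changes it by at most its length. So the travel time between two points is at least the difference
of their values of `⟪u, ·⟫`. Applied to the extreme points of `S` in direction `u`, this bounds the
diameter below by the width of an enclosing strip with normal `u`, hence by the minimum width
(`width_le_travelTimeDiameter`). Conversely, every point of a strip is within half its width of the
middle line, and walking perpendicularly to and from that line takes at most the width
(`travelTimeDiameter_midline_le`). A narrowest strip exists because the unit circle is compact.

For the algorithm, a narrowest strip is flush with an edge of the hull: if both bounding lines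
touched `S` in one point only, a small rotation in the right sense would narrow the strip
(`Strip.IsSmallestEnclosing.exists_tie`, `exists_edge_width_le`). It remains to minimize, over the
edges, the height of the polygon above the edge. Along a convex polygon a local maximum of a linear
functional is global, and the farthest vertex never moves backwards while the edge advances
(`turn_succ_nonneg`). So two pointers that only advance suffice, with `O(h)` moves. Heights are
compared through their squares, which avoids square roots.

The hull is computed by a lexicographic merge sort followed by two scans that build left-turning
chains (`LowerChain.pop`, `LowerChain.push`). The upper chain is the lower chain of the points
reflected in the origin, in reverse order; the reflection preserves orientation and reverses the
lexicographic order. Each running time is a potential argument through `Runs.loop`: every iteration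
is paid for by a decrease of the potential. -/

theorem Plane.inner_eq (u x : Plane) : inner ℝ u x = u 0 * x 0 + u 1 * x 1 := by
  simp [PiLp.inner_apply, Fin.sum_univ_two, mul_comm]

theorem Plane.ext_coord {x y : Plane} (h0 : x 0 = y 0) (h1 : x 1 = y 1) : x = y := by
  ext i
  fin_cases i
  · exact h0
  · exact h1

theorem mem_lineOfEq {u x : Plane} {c : ℝ} : x ∈ lineOfEq u c ↔ inner ℝ u x = c := Iff.rfl

/-- The strip between the lines `⟪u, x⟫ = lo` and `⟪u, x⟫ = hi`, for a normal vector `u` of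
arbitrary length. -/
noncomputable def Strip.ofNormal (u : Plane) (hu : u ≠ 0) (lo hi : ℝ) (h : lo ≤ hi) : Strip where
  normal := ‖u‖⁻¹ • u
  lo := ‖u‖⁻¹ * lo
  hi := ‖u‖⁻¹ * hi
  norm_normal := by
    rw [norm_smul, norm_inv, norm_norm, inv_mul_cancel₀ (norm_ne_zero_iff.2 hu)]
  lo_le_hi := by gcongr

theorem Strip.mem_region_ofNormal {u : Plane} {hu : u ≠ 0} {lo hi : ℝ} {h : lo ≤ hi} {x : Plane} :
    x ∈ (Strip.ofNormal u hu lo hi h).region ↔ lo ≤ inner ℝ u x ∧ inner ℝ u x ≤ hi := by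
  have h0 : 0 < ‖u‖⁻¹ := inv_pos.2 (norm_pos_iff.2 hu)
  simp only [Strip.region, Strip.ofNormal, Set.mem_ofPred_eq, real_inner_smul_left]
  rw [mul_le_mul_iff_right₀ h0, mul_le_mul_iff_right₀ h0]

theorem Strip.width_ofNormal {u : Plane} {hu : u ≠ 0} {lo hi : ℝ} {h : lo ≤ hi} :
    (Strip.ofNormal u hu lo hi h).width = (hi - lo) / ‖u‖ := by
  simp only [Strip.width, Strip.ofNormal]
  ring

theorem Strip.midline_ofNormal {u : Plane} {hu : u ≠ 0} {lo hi : ℝ} {h : lo ≤ hi} :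
    (Strip.ofNormal u hu lo hi h).midline = lineOfEq u ((lo + hi) / 2) := by
  have h0 : ‖u‖⁻¹ ≠ 0 := inv_ne_zero (norm_ne_zero_iff.2 hu)
  ext x
  simp only [Strip.midline, Strip.ofNormal, mem_lineOfEq, real_inner_smul_left]
  rw [← mul_add, mul_div_assoc]
  exact mul_right_inj' h0

theorem Strip.sub_inner_le_width {T : Strip} {p q : Plane} (hp : p ∈ T.region)
    (hq : q ∈ T.region) : inner ℝ T.normal p - inner ℝ T.normal q ≤ T.width := by
  have h1 := hp.2
  have h2 := hq.1
  simp only [Strip.width]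
  linarith

theorem legTime_nonneg (L : AffineSubspace ℝ Plane) (x y : Plane) : 0 ≤ legTime L x y := by
  unfold legTime
  split_ifs
  · exact le_rfl
  · exact dist_nonneg

theorem legTime_le_dist (L : AffineSubspace ℝ Plane) (x y : Plane) : legTime L x y ≤ dist x y := by
  unfold legTime
  split_ifs
  · exact dist_nonneg
  · exact le_rfl

theorem legTime_eq_zero {L : AffineSubspace ℝ Plane} {x y : Plane} (hx : x ∈ L) (hy : y ∈ L) :
    legTime L x y = 0 := if_pos ⟨hx, hy⟩

/-- The distance measured orthogonally to the highway cannot be shortened by the highway. -/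
theorem sub_inner_le_legTime {L : AffineSubspace ℝ Plane} {u : Plane} (hu : ‖u‖ = 1)
    (hL : u ∈ L.directionᗮ) (x y : Plane) : inner ℝ u x - inner ℝ u y ≤ legTime L x y := by
  unfold legTime
  split_ifs with h
  · have := (Submodule.mem_orthogonal' _ _).1 hL _ (AffineSubspace.vsub_mem_direction h.1 h.2)
    rw [vsub_eq_sub, inner_sub_right] at this
    exact this.le
  · rw [← inner_sub_right, dist_eq_norm]
    calc _ ≤ ‖u‖ * ‖x - y‖ := real_inner_le_norm _ _
      _ = _ := by rw [hu, one_mul]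

theorem sub_inner_le_routeTime {L : AffineSubspace ℝ Plane} {u : Plane} (hu : ‖u‖ = 1)
    (hL : u ∈ L.directionᗮ) (p : Plane) (l : List Plane) (q : Plane) :
    inner ℝ u p - inner ℝ u q ≤ routeTime L p l q := by
  induction l generalizing p with
  | nil => exact sub_inner_le_legTime hu hL p q
  | cons x l ih =>
    have := sub_inner_le_legTime hu hL p x
    have := ih x
    simp only [routeTime]
    linarith

theorem routeTime_nonneg (L : AffineSubspace ℝ Plane) (p : Plane) (l : List Plane) (q : Plane) :
    0 ≤ routeTime L p l q := by
  induction l generalizing p with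
  | nil => exact legTime_nonneg _ _ _
  | cons x l ih => exact add_nonneg (legTime_nonneg _ _ _) (ih x)

theorem sub_inner_le_travelTime {L : AffineSubspace ℝ Plane} {u : Plane} (hu : ‖u‖ = 1)
    (hL : u ∈ L.directionᗮ) (p q : Plane) : inner ℝ u p - inner ℝ u q ≤ travelTime L p q :=
  le_ciInf fun l => sub_inner_le_routeTime hu hL p l q

/-- The route walks from `p` to its foot on the line, rides for free to the foot of `q`, and walks
to `q`. -/
theorem travelTime_lineOfEq_le {u : Plane} (hu : ‖u‖ = 1) (c : ℝ) (p q : Plane) :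
    travelTime (lineOfEq u c) p q ≤ |inner ℝ u p - c| + |inner ℝ u q - c| := by
  set f : Plane → Plane := fun x => x - (inner ℝ u x - c) • u with hf
  have hmem : ∀ x, f x ∈ lineOfEq u c := by
    intro x
    rw [mem_lineOfEq, hf]
    simp only [inner_sub_right, inner_smul_right, real_inner_self_eq_norm_sq, hu]
    ring
  have hdist : ∀ x, dist x (f x) = |inner ℝ u x - c| := by
    intro x
    rw [dist_eq_norm, hf]
    simp [norm_smul, hu]
  have hbdd : BddBelow (Set.range fun l => routeTime (lineOfEq u c) p l q) :=
    ⟨0, by rintro _ ⟨l, rfl⟩; exact routeTime_nonneg _ _ _ _⟩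
  refine (ciInf_le hbdd [f p, f q]).trans ?_
  simp only [routeTime]
  have h1 := legTime_le_dist (lineOfEq u c) p (f p)
  have h2 := legTime_le_dist (lineOfEq u c) (f q) q
  rw [legTime_eq_zero (hmem p) (hmem q)]
  rw [hdist] at h1
  rw [dist_comm, hdist] at h2
  linarith

theorem finite_travelTimes {S : Set Plane} (hS : S.Finite) (L : AffineSubspace ℝ Plane) :
    {t | ∃ p ∈ S, ∃ q ∈ S, t = travelTime L p q}.Finite := by
  refine (Set.Finite.image2 (travelTime L) hS hS).subset ?_
  rintro t ⟨p, hp, q, hq, rfl⟩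
  exact ⟨p, hp, q, hq, rfl⟩

theorem travelTimeDiameter_midline_le {S : Set Plane} (hne : S.Nonempty) {T : Strip}
    (hT : S ⊆ T.region) : travelTimeDiameter T.midline S ≤ T.width := by
  obtain ⟨p₀, hp₀⟩ := hne
  refine csSup_le ⟨_, p₀, hp₀, p₀, hp₀, rfl⟩ ?_
  rintro t ⟨p, hp, q, hq, rfl⟩
  refine (travelTime_lineOfEq_le T.norm_normal _ p q).trans ?_
  have h : ∀ x ∈ S, |inner ℝ T.normal x - (T.lo + T.hi) / 2| ≤ T.width / 2 := by
    intro x hx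
    have h1 := (hT hx).1
    have h2 := (hT hx).2
    simp only [Strip.width]
    rw [abs_le]
    constructor <;> linarith
  have := h p hp
  have := h q hq
  linarith

theorem isLine_lineOfEq {u : Plane} (hu : u ≠ 0) (c : ℝ) : IsLine (lineOfEq u c) := by
  have hdir : (lineOfEq u c).direction = (ℝ ∙ u)ᗮ := by
    have h0 : 0 < ‖u‖ ^ 2 := by positivity
    have hx₀ : (c / ‖u‖ ^ 2) • u ∈ lineOfEq u c := by
      rw [mem_lineOfEq, inner_smul_right, real_inner_self_eq_norm_sq]
      field_simp
    ext d
    rw [← AffineSubspace.vadd_mem_iff_mem_direction d hx₀, Submodule.mem_orthogonal_singleton_iff_inner_right,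
      vadd_eq_add, mem_lineOfEq, inner_add_right, mem_lineOfEq.1 hx₀]
    constructor <;> intro h <;> linarith
  have : Fact (Module.finrank ℝ Plane = 1 + 1) := ⟨by simp⟩
  rw [IsLine, hdir]
  exact Submodule.finrank_orthogonal_span_singleton hu

theorem IsLine.exists_normal {L : AffineSubspace ℝ Plane} (hL : IsLine L) :
    ∃ u : Plane, ‖u‖ = 1 ∧ u ∈ L.directionᗮ := by
  have h1 : Module.finrank ℝ L.directionᗮ = 1 := by
    have := Submodule.finrank_add_finrank_orthogonal L.direction
    have h2 : Module.finrank ℝ Plane = 2 := by simp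
    rw [IsLine] at hL
    omega
  have : Nontrivial L.directionᗮ := Module.nontrivial_of_finrank_pos (R := ℝ) (by omega)
  obtain ⟨v, hv⟩ := exists_ne (0 : L.directionᗮ)
  have hv' : (v : Plane) ≠ 0 := fun h => hv (Subtype.ext h)
  refine ⟨‖(v : Plane)‖⁻¹ • (v : Plane), ?_, Submodule.smul_mem _ _ v.2⟩
  rw [norm_smul, norm_inv, norm_norm, inv_mul_cancel₀ (norm_ne_zero_iff.2 hv')]

theorem exists_inner_le_and_le {S : Set Plane} (hS : S.Finite) (hne : S.Nonempty) (u : Plane) :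
    ∃ a ∈ S, ∃ b ∈ S, ∀ x ∈ S, inner ℝ u b ≤ inner ℝ u x ∧ inner ℝ u x ≤ inner ℝ u a := by
  obtain ⟨a, ha, hamax⟩ := hS.exists_maximalFor (fun x => inner ℝ u x) S hne
  obtain ⟨b, hb, hbmin⟩ := hS.exists_minimalFor (fun x => inner ℝ u x) S hne
  refine ⟨a, ha, b, hb, fun x hx => ⟨?_, ?_⟩⟩
  · by_contra! h
    exact absurd (hbmin hx h.le) (not_le.2 h)
  · by_contra! h
    exact absurd (hamax hx h.le) (not_le.2 h)

/-- The extreme points of `S` in the direction normal to `L` span an enclosing strip parallel to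
`L`, and `L` cannot shorten the travel between them below the width of that strip. -/
theorem width_le_travelTimeDiameter {S : Set Plane} (hS : S.Finite) (hne : S.Nonempty) {T : Strip}
    (hT : T.IsSmallestEnclosing S) {L : AffineSubspace ℝ Plane} (hL : IsLine L) :
    T.width ≤ travelTimeDiameter L S := by
  obtain ⟨u, hu, huL⟩ := hL.exists_normal
  obtain ⟨a, ha, b, hb, hab⟩ := exists_inner_le_and_le hS hne u
  calc T.width ≤ inner ℝ u a - inner ℝ u b :=
        hT.2 ⟨u, inner ℝ u b, inner ℝ u a, hu, (hab a ha).1⟩ fun x hx => hab x hx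
    _ ≤ travelTime L a b := sub_inner_le_travelTime hu huL a b
    _ ≤ _ := le_csSup (finite_travelTimes hS L).bddAbove ⟨a, ha, b, hb, rfl⟩

theorem Strip.IsSmallestEnclosing.isOptimalHighway {S : Set Plane} (hS : S.Finite)
    (hne : S.Nonempty) {T : Strip} (hT : T.IsSmallestEnclosing S) :
    IsOptimalHighway S T.midline := by
  refine ⟨isLine_lineOfEq ?_ _, fun L' hL' => (travelTimeDiameter_midline_le hne hT.1).trans
    (width_le_travelTimeDiameter hS hne hT hL')⟩
  intro h
  have := T.norm_normal
  simp [h] at this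

/-- The extent `F u` of the finite set `S` in direction `u` is continuous, so it attains its minimum
on the unit circle. -/
theorem exists_isSmallestEnclosing {S : Set Plane} (hS : S.Finite) (hne : S.Nonempty) :
    ∃ T : Strip, T.IsSmallestEnclosing S := by
  lift S to Finset Plane using hS
  have hne' : S.Nonempty := hne
  set F : Plane → ℝ := fun u => S.sup' hne' (fun x => inner ℝ u x) - S.inf' hne' (fun x => inner ℝ u x)
    with hF
  have hcont : Continuous F := by
    refine Continuous.sub ?_ ?_
    · exact Continuous.finset_sup'_apply hne' fun x _ => by fun_prop
    · exact Continuous.finset_inf'_apply hne' fun x _ => by fun_prop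
  obtain ⟨u, hu, hmin⟩ := (isCompact_sphere (0 : Plane) 1).exists_isMinOn
    (NormedSpace.sphere_nonempty.2 zero_le_one) hcont.continuousOn
  have hu' : ‖u‖ = 1 := by simpa using hu
  have hreg : ∀ (v : Plane), ∀ x ∈ S, S.inf' hne' (fun x => inner ℝ v x) ≤ inner ℝ v x ∧
      inner ℝ v x ≤ S.sup' hne' (fun x => inner ℝ v x) := fun v x hx =>
    ⟨Finset.inf'_le (fun x => inner ℝ v x) hx, Finset.le_sup' (fun x => inner ℝ v x) hx⟩
  obtain ⟨x₀, hx₀⟩ := id hne'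
  refine ⟨⟨u, _, _, hu', (hreg u x₀ hx₀).1.trans (hreg u x₀ hx₀).2⟩, fun x hx => hreg u x hx, ?_⟩
  intro T' hT'
  have h1 : F u ≤ F T'.normal := hmin (by simpa using T'.norm_normal)
  refine h1.trans ?_
  have h2 : S.sup' hne' (fun x => inner ℝ T'.normal x) ≤ T'.hi :=
    Finset.sup'_le _ _ fun x hx => (hT' hx).2
  have h3 : T'.lo ≤ S.inf' hne' (fun x => inner ℝ T'.normal x) :=
    Finset.le_inf' _ _ fun x hx => (hT' hx).1
  simp only [hF, Strip.width]
  linarith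

/-- One of the two bounding lines of a smallest enclosing strip contains two points of the set. -/
theorem Strip.IsSmallestEnclosing.exists_tie {S : Set Plane} (hS : S.Finite)
    (hne : S.Nontrivial) {T : Strip} (hT : T.IsSmallestEnclosing S) :
    ∃ a ∈ S, ∃ b ∈ S, a ≠ b ∧ inner ℝ T.normal a = inner ℝ T.normal b ∧
      ((∀ x ∈ S, inner ℝ T.normal x ≤ inner ℝ T.normal a) ∨
        (∀ x ∈ S, inner ℝ T.normal a ≤ inner ℝ T.normal x)) := by
  set n := T.normal with hn
  obtain ⟨a, ha, b, hb, hab⟩ := exists_inner_le_and_le hS hne.nonempty n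
  by_contra! hcon
  have hA : ∀ x ∈ S, x ≠ a → inner ℝ n x < inner ℝ n a := by
    intro x hx hxa
    refine lt_of_le_of_ne (hab x hx).2 fun h => ?_
    obtain ⟨⟨y, hy, hlt⟩, -⟩ := hcon a ha x hx hxa.symm h.symm
    exact absurd hlt (not_lt.2 (hab y hy).2)
  have hB : ∀ x ∈ S, x ≠ b → inner ℝ n b < inner ℝ n x := by
    intro x hx hxb
    refine lt_of_le_of_ne (hab x hx).1 fun h => ?_
    obtain ⟨-, ⟨y, hy, hlt⟩⟩ := hcon b hb x hx hxb.symm h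
    exact absurd hlt (not_lt.2 (hab y hy).1)
  have hne' : b ≠ a := by
    rintro rfl
    obtain ⟨x, hx, hxb⟩ := hne.exists_ne b
    exact lt_asymm (hA x hx hxb) (hB x hx hxb)
  have hw : inner ℝ n a - inner ℝ n b ≤ T.width := T.sub_inner_le_width (hT.1 ha) (hT.1 hb)
  have hw0 : inner ℝ n b < inner ℝ n a := hA b hb hne'
  have hn1 : ‖n‖ = 1 := T.norm_normal
  -- The normal is tilted to `n + t • m` with `m` orthogonal to `n`. For small `t` the strict
  -- inequalities `hA`, `hB` keep `a` and `b` extreme. The sign of `t` is chosen so that the extent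
  -- between them does not grow, while the norm of the normal exceeds `1`; so the width drops
  -- strictly.
  set m : Plane := !₂[-n 1, n 0] with hm
  have hnm : inner ℝ n m = 0 := by
    rw [Plane.inner_eq]; simp [hm]; ring
  have hm0 : m ≠ 0 := by
    intro h
    have h0 := congrArg (fun x : Plane => x 0) h
    have h1 := congrArg (fun x : Plane => x 1) h
    simp [hm] at h0 h1
    have : n = 0 := Plane.ext_coord (by simpa using h1) (by simpa using h0)
    rw [this] at hn1
    simp at hn1
  have key : ∀ᶠ t : ℝ in nhds 0, ∀ x ∈ S, inner ℝ (n + t • m) b ≤ inner ℝ (n + t • m) x ∧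
      inner ℝ (n + t • m) x ≤ inner ℝ (n + t • m) a := by
    refine (Filter.eventually_all_finite hS).2 fun x hx => ?_
    have hc : ∀ y : Plane, Filter.Tendsto (fun t : ℝ => inner ℝ (n + t • m) y) (nhds 0)
        (nhds (inner ℝ n y)) := by
      intro y
      have : Continuous fun t : ℝ => inner ℝ (n + t • m) y := by fun_prop
      simpa using this.tendsto 0
    refine Filter.Eventually.and ?_ ?_
    · rcases eq_or_ne x b with rfl | hxb
      · exact Filter.Eventually.of_forall fun _ => le_rfl
      · exact ((hc b).eventually_lt (hc x) (hB x hx hxb)).mono fun _ h => h.le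
    · rcases eq_or_ne x a with rfl | hxa
      · exact Filter.Eventually.of_forall fun _ => le_rfl
      · exact ((hc x).eventually_lt (hc a) (hA x hx hxa)).mono fun _ h => h.le
  obtain ⟨ε, hε, hball⟩ := Metric.eventually_nhds_iff.1 key
  obtain ⟨t, ht0, htε, hts⟩ : ∃ t : ℝ, t ≠ 0 ∧ dist t 0 < ε ∧
      t * (inner ℝ m a - inner ℝ m b) ≤ 0 := by
    rcases le_total (inner ℝ m a - inner ℝ m b) 0 with h | h
    · refine ⟨ε / 2, by positivity, ?_, mul_nonpos_of_nonneg_of_nonpos (by positivity) h⟩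
      rw [Real.dist_eq, sub_zero, abs_of_pos (by positivity)]
      linarith
    · refine ⟨-(ε / 2), by simpa using hε.ne', ?_,
        mul_nonpos_of_nonpos_of_nonneg (by linarith) h⟩
      rw [Real.dist_eq, sub_zero, abs_neg, abs_of_pos (by positivity)]
      linarith
  have hreg := hball htε
  have hnorm : 1 < ‖n + t • m‖ := by
    have h1 : ‖n + t • m‖ ^ 2 = 1 + t ^ 2 * ‖m‖ ^ 2 := by
      rw [norm_add_sq_real, hn1, inner_smul_right, hnm, norm_smul, mul_pow, Real.norm_eq_abs,
        sq_abs]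
      ring
    have h2 : 0 < t ^ 2 * ‖m‖ ^ 2 := by positivity
    nlinarith [norm_nonneg (n + t • m)]
  have hu0 : n + t • m ≠ 0 := fun h => by rw [h, norm_zero] at hnorm; linarith
  have hle := hT.2 (Strip.ofNormal (n + t • m) hu0 _ _ (hreg b hb).2)
    fun x hx => Strip.mem_region_ofNormal.2 (hreg x hx)
  rw [Strip.width_ofNormal, le_div_iff₀ (by linarith)] at hle
  simp only [inner_add_left, real_inner_smul_left] at hle
  nlinarith

theorem Strip.convex_region (T : Strip) : Convex ℝ T.region := by
  have h : T.region = {x | T.lo ≤ innerSL ℝ T.normal x} ∩ {x | innerSL ℝ T.normal x ≤ T.hi} := rfl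
  rw [h]
  exact (convex_halfSpace_ge (innerSL ℝ T.normal).isLinear _).inter
    (convex_halfSpace_le (innerSL ℝ T.normal).isLinear _)

/-- Strips are convex, so enclosing a set and enclosing its hull are the same; this passes from the
points to the hull vertices. -/
theorem Strip.isSmallestEnclosing_congr {S S' : Set Plane} (h : convexHull ℝ S = convexHull ℝ S')
    (T : Strip) : T.IsSmallestEnclosing S ↔ T.IsSmallestEnclosing S' := by
  have key : ∀ T : Strip, S ⊆ T.region ↔ S' ⊆ T.region := by
    intro T
    rw [← T.convex_region.convexHull_subset_iff, h, T.convex_region.convexHull_subset_iff]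
  simp only [Strip.IsSmallestEnclosing, key]

/-! # Convex polygons and their edge strips -/

/-- `w` runs periodically through the vertices of a convex polygon with `h` vertices in
counterclockwise order. -/
structure IsPeriodicPolygon (h : ℕ) (w : ℕ → Plane) : Prop where
  two_le : 2 ≤ h
  periodic : ∀ k, w (k + h) = w k
  ne_succ : ∀ k, w k ≠ w (k + 1)
  orient_pos : ∀ i j k, i < j → j < k → k < i + h → 0 < orient (w i) (w j) (w k)

theorem orient_rotate (p q r : Plane) : orient p q r = orient q r p := by
  simp only [orient]; ring

theorem orient_self_left (p q : Plane) : orient p q p = 0 := by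
  simp only [orient]; ring

theorem orient_self_right (p q : Plane) : orient p q q = 0 := by
  simp only [orient]; ring

/-- Cramer's rule: `x - c` is expanded in `p - c` and `q - c`, with signed areas as coefficients,
and the functional is applied. -/
theorem inner_sub_mul_orient (u p c q x : Plane) :
    orient p c q * (inner ℝ u x - inner ℝ u c) =
      orient p c x * (inner ℝ u q - inner ℝ u c) + orient c q x * (inner ℝ u p - inner ℝ u c) := by
  simp only [Plane.inner_eq, orient]; ring

/-- A linear functional that is at most its value at the apex `c` on both legs of an angle is at
most that value inside the angle. -/
theorem inner_le_of_mem_angle {u p c q x : Plane} (h : 0 < orient p c q) (h1 : 0 ≤ orient p c x)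
    (h2 : 0 ≤ orient c q x) (hp : inner ℝ u p ≤ inner ℝ u c) (hq : inner ℝ u q ≤ inner ℝ u c) :
    inner ℝ u x ≤ inner ℝ u c := by
  have := inner_sub_mul_orient u p c q x
  have h3 := mul_nonneg h1 (sub_nonneg.2 hq)
  have h4 := mul_nonneg h2 (sub_nonneg.2 hp)
  have h5 : orient p c q * (inner ℝ u x - inner ℝ u c) ≤ 0 := by linarith
  have := nonpos_of_mul_nonpos_right h5 h
  linarith

/-- The normal vector of the edge that starts at the `i`-th vertex; it points inside. -/
noncomputable def edgeNormal (w : ℕ → Plane) (i : ℕ) : Plane :=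
  !₂[-(w (i + 1) 1 - w i 1), w (i + 1) 0 - w i 0]

theorem inner_edgeNormal (w : ℕ → Plane) (i : ℕ) (x : Plane) :
    inner ℝ (edgeNormal w i) x =
      (w (i + 1) 0 - w i 0) * x 1 - (w (i + 1) 1 - w i 1) * x 0 := by
  rw [Plane.inner_eq]
  simp [edgeNormal]
  ring

theorem inner_edgeNormal_sub (w : ℕ → Plane) (i : ℕ) (x : Plane) :
    inner ℝ (edgeNormal w i) x - inner ℝ (edgeNormal w i) (w i) = orient (w i) (w (i + 1)) x := by
  simp only [inner_edgeNormal, orient]; ring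

/-- The `j`-th vertex has maximal distance from the edge that starts at the `i`-th one. -/
def IsFarthest (w : ℕ → Plane) (i j : ℕ) : Prop :=
  ∀ k, inner ℝ (edgeNormal w i) (w k) ≤ inner ℝ (edgeNormal w i) (w j)

/-- The cross product of the `i`-th and the `j`-th edge vector. -/
noncomputable def turn (w : ℕ → Plane) (i j : ℕ) : ℝ :=
  inner ℝ (edgeNormal w i) (w (j + 1)) - inner ℝ (edgeNormal w i) (w j)

theorem turn_self (w : ℕ → Plane) (i : ℕ) : turn w i i = 0 := by
  simp only [turn, inner_edgeNormal]; ring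

/-- The height of the polygon above its `i`-th edge, squared, when `j` is farthest from it. -/
noncomputable def sqHeight (w : ℕ → Plane) (i j : ℕ) : ℝ :=
  orient (w i) (w (i + 1)) (w j) ^ 2 / (edgeNormal w i 0 ^ 2 + edgeNormal w i 1 ^ 2)

namespace IsPeriodicPolygon

variable {h : ℕ} {w : ℕ → Plane}

theorem exists_rep (hw : IsPeriodicPolygon h w) (j k : ℕ) : ∃ k', j ≤ k' ∧ k' < j + h ∧ w k' = w k := by
  have hpos : 0 < h := by have := hw.two_le; omega
  have hper : Function.Periodic w h := hw.periodic
  -- Modulo `h`, the term `j * (h - 1)` is `-j`, written without truncated subtraction.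
  refine ⟨j + (k + j * (h - 1)) % h, by omega, by have := Nat.mod_lt (k + j * (h - 1)) hpos; omega, ?_⟩
  rw [← hper.map_mod_nat, Nat.add_mod_mod, ← hper.map_mod_nat k]
  congr 1
  obtain ⟨m, rfl⟩ : ∃ m, h = m + 1 := ⟨h - 1, by omega⟩
  rw [show j + (k + j * (m + 1 - 1)) = k + j * (m + 1) by simp; ring, Nat.add_mul_mod_self_right]

theorem orient_edge_nonneg (hw : IsPeriodicPolygon h w) (j k : ℕ) :
    0 ≤ orient (w j) (w (j + 1)) (w k) := by
  obtain ⟨k', h1, h2, h3⟩ := hw.exists_rep j k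
  rw [← h3]
  rcases Nat.lt_or_ge (j + 1) k' with h4 | h4
  · exact (hw.orient_pos j (j + 1) k' (by omega) h4 h2).le
  · obtain rfl | rfl : k' = j ∨ k' = j + 1 := by omega
    · rw [orient_self_left]
    · rw [orient_self_right]

/-- The whole polygon lies in the angle at the vertex `j + 1`, so comparing with the two neighbours
is enough. A digon has no proper angle, hence `h ≠ 2`. -/
theorem inner_le_of_local_max (hw : IsPeriodicPolygon h w) (hh : h ≠ 2) {u : Plane} {j : ℕ}
    (h1 : inner ℝ u (w j) ≤ inner ℝ u (w (j + 1)))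
    (h2 : inner ℝ u (w (j + 2)) ≤ inner ℝ u (w (j + 1))) (k : ℕ) :
    inner ℝ u (w k) ≤ inner ℝ u (w (j + 1)) := by
  have := hw.two_le
  exact inner_le_of_mem_angle (hw.orient_pos j (j + 1) (j + 2) (by omega) (by omega) (by omega))
    (hw.orient_edge_nonneg j k) (hw.orient_edge_nonneg (j + 1) k) h1 h2

/-- The monotonicity behind the calipers. By antisymmetry of the cross product, `turn w a k` is also
the increment of `-edgeNormal w k` along edge `a`. If it changed from nonnegative at `i` to negative
at `i + 1`, the vertex `i + 1` would maximize this functional, that is, be no farther inside than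
edge `k` itself; strict convexity forbids this. -/
theorem turn_succ_nonneg (hw : IsPeriodicPolygon h w) (hh : h ≠ 2) {i k : ℕ} (hik : i + 1 ≤ k)
    (hk : k < i + h) (ht : 0 ≤ turn w i k) : 0 ≤ turn w (i + 1) k := by
  have h2 := hw.two_le
  rcases hik.eq_or_lt with rfl | hik
  · rw [turn_self]
  by_contra! hneg
  have e : ∀ a, turn w a k = inner ℝ (-edgeNormal w k) (w (a + 1)) -
      inner ℝ (-edgeNormal w k) (w a) := by
    intro a
    simp only [turn, inner_neg_left, inner_edgeNormal]; ring
  rw [e] at ht hneg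
  have hmax := hw.inner_le_of_local_max hh (u := -edgeNormal w k) (j := i) (by linarith)
    (by linarith) k
  have hpos := hw.orient_pos k (k + 1) (i + 1 + h) (by omega) (by omega) (by omega)
  rw [hw.periodic, ← inner_edgeNormal_sub] at hpos
  simp only [inner_neg_left] at hmax
  linarith

theorem turn_succ_pos (hw : IsPeriodicPolygon h w) (hh : h ≠ 2) (i : ℕ) :
    0 < turn w i (i + 1) := by
  have h2 := hw.two_le
  have := hw.orient_pos i (i + 1) (i + 2) (by omega) (by omega) (by omega)
  simp only [turn, inner_edgeNormal]
  simp only [orient] at this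
  linarith

/-- The turns before and after vertex `j + 1` make it a local maximum of the height above edge `i`.
In a digon all heights are `0`, and nothing is needed. -/
theorem isFarthest (hw : IsPeriodicPolygon h w) {i j : ℕ}
    (h1 : h = 2 ∨ 0 ≤ turn w i j) (h2 : turn w i (j + 1) ≤ 0) :
    IsFarthest w i (j + 1) := by
  intro k
  by_cases hh : h = 2
  · have e : ∀ k, inner ℝ (edgeNormal w i) (w k) = inner ℝ (edgeNormal w i) (w i) := by
      intro k
      obtain ⟨k', h3, h4, h5⟩ := hw.exists_rep i k
      rw [← h5]
      obtain rfl | rfl : k' = i ∨ k' = i + 1 := by omega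
      · rfl
      · simp only [inner_edgeNormal]; ring
    rw [e k, e (j + 1)]
  · have h1 := h1.resolve_left hh
    simp only [turn] at h1 h2
    exact hw.inner_le_of_local_max hh (by linarith) (by linarith) k

theorem edgeNormal_ne_zero (hw : IsPeriodicPolygon h w) (i : ℕ) : edgeNormal w i ≠ 0 := by
  intro h0
  have e0 := congrArg (fun x : Plane => x 0) h0
  have e1 := congrArg (fun x : Plane => x 1) h0
  simp [edgeNormal] at e0 e1
  exact hw.ne_succ i (Plane.ext_coord (by linarith) (by linarith))

theorem inner_edgeNormal_le (hw : IsPeriodicPolygon h w) (i k : ℕ) :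
    inner ℝ (edgeNormal w i) (w i) ≤ inner ℝ (edgeNormal w i) (w k) := by
  have := hw.orient_edge_nonneg i k
  rw [← inner_edgeNormal_sub] at this
  linarith

/-- Two vertices on a supporting line are adjacent. -/
theorem eq_or_eq_of_tie (hw : IsPeriodicPolygon h w) {n : Plane} {i j : ℕ} (hij : i < j)
    (hj : j < i + h) (hn : n ≠ 0) (heq : inner ℝ n (w i) = inner ℝ n (w j))
    (hmax : ∀ k, inner ℝ n (w k) ≤ inner ℝ n (w i)) : j = i + 1 ∨ j + 1 = i + h := by
  by_contra! hcon
  have p1 := hw.orient_pos i (i + 1) j (by omega) (by omega) (by omega)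
  have p2 := hw.orient_pos i j (j + 1) (by omega) (by omega) (by omega)
  have m1 := hmax (i + 1)
  have m2 := hmax (j + 1)
  -- Since `n` is orthogonal to the chord `D`, the functional relative to `w i` is proportional to
  -- the signed area over the chord, with a factor of the sign of `μ`. Were the two vertices not
  -- adjacent, `w (i + 1)` and `w (j + 1)` would lie strictly on opposite sides of the chord, so
  -- maximality would force `μ = 0` and then `n = 0`.
  set D := w j - w i with hD
  have id : ∀ x : Plane, (D 0 ^ 2 + D 1 ^ 2) * (inner ℝ n x - inner ℝ n (w i)) =
      orient (w i) (w j) x * (n 1 * D 0 - n 0 * D 1) := by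
    intro x
    have : (n 0 * D 0 + n 1 * D 1) = 0 := by
      simp only [Plane.inner_eq] at heq
      simp only [hD, PiLp.sub_apply]
      linarith
    simp only [Plane.inner_eq, orient]
    simp only [hD, PiLp.sub_apply] at this ⊢
    linear_combination ((w j 0 - w i 0) * (x 0 - w i 0) + (w j 1 - w i 1) * (x 1 - w i 1)) * this
  have i1 := id (w (i + 1))
  have i2 := id (w (j + 1))
  have hD0 : 0 < D 0 ^ 2 + D 1 ^ 2 := by
    by_contra! hle
    have a0 : D 0 = 0 := by nlinarith [sq_nonneg (D 0), sq_nonneg (D 1)]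
    have a1 : D 1 = 0 := by nlinarith [sq_nonneg (D 0), sq_nonneg (D 1)]
    simp only [hD, PiLp.sub_apply] at a0 a1
    simp only [orient, a0, a1] at p2
    linarith
  have q1 : orient (w i) (w j) (w (i + 1)) < 0 := by
    have : orient (w i) (w j) (w (i + 1)) = -orient (w i) (w (i + 1)) (w j) := by
      simp only [orient]; ring
    linarith
  set μ := n 1 * D 0 - n 0 * D 1 with hμ
  have hμ1 : 0 ≤ μ := by
    by_contra! hlt
    have := mul_pos_of_neg_of_neg q1 hlt
    nlinarith
  have hμ2 : μ ≤ 0 := by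
    by_contra! hlt
    have := mul_pos p2 hlt
    nlinarith
  have hμ0 : n 1 * D 0 - n 0 * D 1 = 0 := le_antisymm hμ2 hμ1
  have hort : n 0 * D 0 + n 1 * D 1 = 0 := by
    simp only [Plane.inner_eq] at heq
    simp only [hD, PiLp.sub_apply]
    linarith
  have z0 : (D 0 ^ 2 + D 1 ^ 2) * n 0 = 0 := by linear_combination D 0 * hort - D 1 * hμ0
  have z1 : (D 0 ^ 2 + D 1 ^ 2) * n 1 = 0 := by linear_combination D 1 * hort + D 0 * hμ0
  exact hn (Plane.ext_coord (by simpa using (mul_eq_zero.1 z0).resolve_left hD0.ne')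
    (by simpa using (mul_eq_zero.1 z1).resolve_left hD0.ne'))

/-- Some edge of the polygon is parallel to a smallest enclosing strip. -/
theorem exists_edge_width_le (hw : IsPeriodicPolygon h w) {T : Strip}
    (hT : T.IsSmallestEnclosing (Set.range w)) :
    ∃ i < h, ∀ j, inner ℝ (edgeNormal w i) (w j) - inner ℝ (edgeNormal w i) (w i) ≤
      T.width * ‖edgeNormal w i‖ := by
  have hfin : (Set.range w).Finite := by
    refine ((Set.finite_lt_nat h).image w).subset ?_
    rintro _ ⟨k, rfl⟩
    obtain ⟨k', -, h2, h3⟩ := hw.exists_rep 0 k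
    exact ⟨k', by simpa using h2, h3⟩
  have hnt : (Set.range w).Nontrivial := ⟨w 0, ⟨0, rfl⟩, w 1, ⟨1, rfl⟩, hw.ne_succ 0⟩
  have hn0 : T.normal ≠ 0 := by
    intro h0
    have := T.norm_normal
    simp [h0] at this
  obtain ⟨_, ⟨a, rfl⟩, _, ⟨b, rfl⟩, hab, heq, hext⟩ := hT.exists_tie hfin hnt
  obtain ⟨b', hb1, hb2, hb3⟩ := hw.exists_rep a b
  rw [← hb3] at hab heq
  have hlt : a < b' := lt_of_le_of_ne hb1 fun h => hab (h ▸ rfl)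
  have hadj : b' = a + 1 ∨ b' + 1 = a + h := by
    rcases hext with hmax | hmin
    · exact hw.eq_or_eq_of_tie hlt hb2 hn0 heq fun k => hmax _ ⟨k, rfl⟩
    · refine hw.eq_or_eq_of_tie (n := -T.normal) hlt hb2 (neg_ne_zero.2 hn0) ?_ fun k => ?_
      · simp only [inner_neg_left, heq]
      · simp only [inner_neg_left, neg_le_neg_iff]
        exact hmin _ ⟨k, rfl⟩
  obtain ⟨i, hi⟩ : ∃ i, inner ℝ T.normal (w i) = inner ℝ T.normal (w (i + 1)) := by
    rcases hadj with rfl | hadj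
    · exact ⟨a, heq⟩
    · exact ⟨b', by rw [hadj, hw.periodic, heq]⟩
  have hper : Function.Periodic w h := hw.periodic
  have hpos : 0 < h := by have := hw.two_le; omega
  have e0 : w (i % h) = w i := hper.map_mod_nat i
  have e1 : w (i % h + 1) = w (i + 1) := by
    rw [← hper.map_mod_nat, Nat.mod_add_mod, hper.map_mod_nat]
  have hi' : inner ℝ T.normal (w (i % h)) = inner ℝ T.normal (w (i % h + 1)) := by rw [e0, e1, hi]
  refine ⟨i % h, Nat.mod_lt _ hpos, fun j => ?_⟩
  generalize i % h = i at hi'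
  set N := edgeNormal w i with hN
  set n := T.normal with hn
  have hn1 : n 0 ^ 2 + n 1 ^ 2 = 1 := by
    have : inner ℝ n n = ‖n‖ ^ 2 := real_inner_self_eq_norm_sq n
    rw [T.norm_normal, Plane.inner_eq] at this
    linarith
  have hperp : n 0 * N 1 - n 1 * N 0 = 0 := by
    simp only [Plane.inner_eq] at hi'
    simp [hN, edgeNormal]
    linarith
  -- The edge normal `N` is parallel to the unit vector `n`, so it is `⟪N, n⟫ • n`, and this factor
  -- is at most `‖N‖` in absolute value.
  have key : inner ℝ N (w j) - inner ℝ N (w i) =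
      inner ℝ N n * (inner ℝ n (w j) - inner ℝ n (w i)) := by
    simp only [Plane.inner_eq]
    linear_combination (-(N 0 * (w j 0 - w i 0) + N 1 * (w j 1 - w i 1))) * hn1 +
      (n 0 * (w j 1 - w i 1) - n 1 * (w j 0 - w i 0)) * hperp
  have hw1 := T.sub_inner_le_width (hT.1 ⟨j, rfl⟩) (hT.1 ⟨i, rfl⟩)
  have hw2 := T.sub_inner_le_width (hT.1 ⟨i, rfl⟩) (hT.1 ⟨j, rfl⟩)
  have hbound : |inner ℝ N n| ≤ ‖N‖ := by
    have := abs_real_inner_le_norm N n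
    rwa [T.norm_normal, mul_one] at this
  rw [key, mul_comm T.width]
  calc _ ≤ |inner ℝ N n * (inner ℝ n (w j) - inner ℝ n (w i))| := le_abs_self _
    _ = |inner ℝ N n| * |inner ℝ n (w j) - inner ℝ n (w i)| := abs_mul _ _
    _ ≤ ‖N‖ * T.width := by
        gcongr
        rw [abs_le]
        constructor <;> linarith

/-- The strip spanned by the edge that starts at the `i`-th vertex and the `j`-th vertex. -/
noncomputable def edgeStrip (hw : IsPeriodicPolygon h w) (i j : ℕ) : Strip :=
  Strip.ofNormal (edgeNormal w i) (hw.edgeNormal_ne_zero i) _ _ (hw.inner_edgeNormal_le i j)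

/-- It suffices to compare with any vertex `j'` over each edge `i'`: its height is at most the width
of every strip flush with that edge, and a smallest strip is flush with some edge. -/
theorem isSmallestEnclosing_edgeStrip (hw : IsPeriodicPolygon h w) {i j : ℕ}
    (hij : IsFarthest w i j)
    (hmin : ∀ i' < h, ∃ j', sqHeight w i j ≤ sqHeight w i' j') :
    (hw.edgeStrip i j).IsSmallestEnclosing (Set.range w) := by
  have hfin : (Set.range w).Finite := by
    refine ((Set.finite_lt_nat h).image w).subset ?_
    rintro _ ⟨k, rfl⟩
    obtain ⟨k', -, h2, h3⟩ := hw.exists_rep 0 k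
    exact ⟨k', by simpa using h2, h3⟩
  obtain ⟨T, hT⟩ := exists_isSmallestEnclosing hfin ⟨_, 0, rfl⟩
  refine ⟨?_, fun T' hT' => le_trans ?_ (hT.2 T' hT')⟩
  · rintro _ ⟨k, rfl⟩
    exact Strip.mem_region_ofNormal.2 ⟨hw.inner_edgeNormal_le i k, hij k⟩
  obtain ⟨i', hi', hle⟩ := hw.exists_edge_width_le hT
  obtain ⟨j', hj'⟩ := hmin i' hi'
  have e : ∀ i j, sqHeight w i j = ((inner ℝ (edgeNormal w i) (w j) -
      inner ℝ (edgeNormal w i) (w i)) / ‖edgeNormal w i‖) ^ 2 := by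
    intro i j
    rw [sqHeight, inner_edgeNormal_sub, div_pow, EuclideanSpace.real_norm_sq_eq,
      Fin.sum_univ_two]
  have hN := norm_pos_iff.2 (hw.edgeNormal_ne_zero i')
  have h1 := (div_le_iff₀ hN).2 (hle j')
  have h0 : 0 ≤ (inner ℝ (edgeNormal w i') (w j') - inner ℝ (edgeNormal w i') (w i')) /
      ‖edgeNormal w i'‖ := div_nonneg (sub_nonneg.2 (hw.inner_edgeNormal_le i' j')) hN.le
  rw [e, e] at hj'
  rw [edgeStrip, Strip.width_ofNormal]
  exact ((le_abs_self _).trans (abs_le_of_sq_le_sq hj' h0)).trans h1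

end IsPeriodicPolygon

/-! ## Vertices of the convex hull -/

/-- A window of fewer than `h + 1` consecutive indices is shifted by a multiple of `h` to start
below `h`; reduced modulo `h`, a triple in it is then a cyclic rotation of an increasing one, and
`orient` is invariant under rotation. -/
theorem isPeriodicPolygon_of_orient_pos {h : ℕ} {v : Fin h → Plane} (h2 : 2 ≤ h)
    (hinj : Function.Injective v)
    (hpos' : ∀ i j k : Fin h, i < j → j < k → 0 < orient (v i) (v j) (v k)) :
    IsPeriodicPolygon h (fun k => v ⟨k % h, Nat.mod_lt k (by omega)⟩) where
  two_le := h2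
  periodic := by
    intro k
    simp
  ne_succ := by
    intro k heq
    have := congrArg Fin.val (hinj heq)
    simp only at this
    rcases Nat.lt_or_ge (k % h + 1) h with h3 | h3
    · rw [← Nat.mod_add_mod, Nat.mod_eq_of_lt h3] at this
      omega
    · have h4 : k % h + 1 = h := by have := Nat.mod_lt k (show 0 < h by omega); omega
      rw [← Nat.mod_add_mod, h4, Nat.mod_self] at this
      omega
  orient_pos := by
    have hpos : 0 < h := by omega
    have mod_eq : ∀ i, h ≤ i → i < 2 * h → i % h = i - h := by
      intro i h1 h2
      rw [Nat.mod_eq_sub_mod h1, Nat.mod_eq_of_lt (by omega)]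
    have base : ∀ i j k, i < h → i < j → j < k → k < i + h →
        0 < orient (v ⟨i % h, Nat.mod_lt i hpos⟩) (v ⟨j % h, Nat.mod_lt j hpos⟩)
          (v ⟨k % h, Nat.mod_lt k hpos⟩) := by
      intro i j k hi hij hjk hk
      have ei := Nat.mod_eq_of_lt hi
      rcases Nat.lt_or_ge j h with hj | hj
      · have ej := Nat.mod_eq_of_lt hj
        rcases Nat.lt_or_ge k h with hk' | hk'
        · have ek := Nat.mod_eq_of_lt hk'
          exact hpos' _ _ _ (by simp only [Fin.mk_lt_mk]; omega) (by simp only [Fin.mk_lt_mk]; omega)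
        · have ek := mod_eq k hk' (by omega)
          rw [orient_rotate, orient_rotate]
          exact hpos' _ _ _ (by simp only [Fin.mk_lt_mk]; omega) (by simp only [Fin.mk_lt_mk]; omega)
      · have ej := mod_eq j hj (by omega)
        have ek := mod_eq k (by omega) (by omega)
        rw [orient_rotate]
        exact hpos' _ _ _ (by simp only [Fin.mk_lt_mk]; omega) (by simp only [Fin.mk_lt_mk]; omega)
    intro i j k hij hjk hk
    have hdiv := Nat.div_add_mod i h
    have hlt := Nat.mod_lt i hpos
    have e : ∀ a, i ≤ a → (a - h * (i / h)) % h = a % h := by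
      intro a ha
      rw [Nat.sub_mul_mod (by omega)]
    have := base (i - h * (i / h)) (j - h * (i / h)) (k - h * (i / h)) (by omega) (by omega)
      (by omega) (by omega)
    simpa only [e i le_rfl, e j hij.le, e k (hij.trans hjk).le] using this

namespace IsConvexHullCycle

variable {h : ℕ} {v : Fin h → Plane} {S : Set Plane}

/-- Krein–Milman; the closure is superfluous because there are finitely many vertices. -/
theorem convexHull_eq (hv : IsConvexHullCycle v S) (hS : S.Finite) :
    convexHull ℝ (Set.range v) = convexHull ℝ S := by
  have hfin : (Set.range v).Finite := Set.finite_range v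
  rw [← (hfin.isClosed_convexHull ℝ).closure_eq, hv.2.1]
  exact closure_convexHull_extremePoints (hS.isCompact_convexHull ℝ) (convex_convexHull ℝ S)

theorem range_subset (hv : IsConvexHullCycle v S) : Set.range v ⊆ S := by
  rw [hv.2.1]
  exact extremePoints_convexHull_subset

theorem two_le (hv : IsConvexHullCycle v S) (hS : S.Finite) (hne : S.Nontrivial) : 2 ≤ h := by
  by_contra! hlt
  have hsub : (Set.range v).Subsingleton := by
    rintro _ ⟨i, rfl⟩ _ ⟨j, rfl⟩
    congr 1
    exact Fin.ext (by omega)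
  have h1 : S ⊆ convexHull ℝ (Set.range v) := hv.convexHull_eq hS ▸ subset_convexHull ℝ S
  rw [hsub.convex.convexHull_eq] at h1
  exact Set.not_subsingleton_iff.2 hne (hsub.anti h1)

theorem le_ncard (hv : IsConvexHullCycle v S) (hS : S.Finite) : h ≤ S.ncard := by
  have h1 := Set.ncard_le_ncard hv.range_subset hS
  rwa [← Set.image_univ, Set.ncard_image_of_injective _ hv.1, Set.ncard_univ, Nat.card_fin] at h1

theorem isPeriodicPolygon (hv : IsConvexHullCycle v S) (h2 : 2 ≤ h) :
    IsPeriodicPolygon h (fun k => v ⟨k % h, Nat.mod_lt k (by omega)⟩) :=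
  isPeriodicPolygon_of_orient_pos h2 hv.1 hv.2.2

end IsConvexHullCycle

/-! # Reasoning about programs -/

namespace RealRAM

/-- `P`, started in `s`, halts in a state and after a number of steps that satisfy `Q`. -/
def Runs (W : ℕ) (P : Prog) (s : State) (Q : State → ℕ → Prop) : Prop :=
  ∃ s' t, Exec W P s s' t ∧ Q s' t

attribute [simp] Test.Ok Test.eval Test.cost IExpr.Ok IExpr.eval IExpr.cost
  RExpr.Ok RExpr.eval RExpr.cost

variable {W : ℕ} {s : State} {Q : State → ℕ → Prop}

theorem Runs.mono {P : Prog} {Q' : State → ℕ → Prop} (h : Runs W P s Q)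
    (hQ : ∀ s' t, Q s' t → Q' s' t) : Runs W P s Q' := by
  obtain ⟨s', t, he, hq⟩ := h
  exact ⟨s', t, he, hQ _ _ hq⟩

-- This and the following equivalences compute weakest preconditions, so `simp` executes loop-free
-- code symbolically and leaves only word bounds, nonzero divisors and the postcondition.
@[simp]
theorem runs_skip : Runs W Prog.skip s Q ↔ Q s 1 := by
  constructor
  · rintro ⟨s', t, he, hq⟩
    cases he
    exact hq
  · exact fun h => ⟨_, _, Exec.skip s, h⟩

@[simp]
theorem runs_iset {x : ℕ} {e : IExpr} : Runs W (Prog.iset x e) s Q ↔ e.Ok W s ∧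
    Q { s with ireg := Function.update s.ireg x (e.eval s) } (e.cost + 1) := by
  constructor
  · rintro ⟨s', t, he, hq⟩
    cases he with
    | iset _ _ _ he => exact ⟨he, hq⟩
  · exact fun h => ⟨_, _, Exec.iset s x e h.1, h.2⟩

@[simp]
theorem runs_rset {x : ℕ} {e : RExpr} : Runs W (Prog.rset x e) s Q ↔ e.Ok W s ∧
    Q { s with rreg := Function.update s.rreg x (e.eval s) } (e.cost + 1) := by
  constructor
  · rintro ⟨s', t, he, hq⟩
    cases he with
    | rset _ _ _ he => exact ⟨he, hq⟩
  · exact fun h => ⟨_, _, Exec.rset s x e h.1, h.2⟩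

@[simp]
theorem runs_rput {A : ℕ} {i : IExpr} {e : RExpr} : Runs W (Prog.rput A i e) s Q ↔
    (i.Ok W s ∧ e.Ok W s) ∧
    Q { s with
        rarr := Function.update s.rarr A (Function.update (s.rarr A) (i.eval s) (e.eval s)) }
      (i.cost + e.cost + 1) := by
  constructor
  · rintro ⟨s', t, he, hq⟩
    cases he with
    | rput _ _ _ _ hi he => exact ⟨⟨hi, he⟩, hq⟩
  · exact fun h => ⟨_, _, Exec.rput s A i e h.1.1 h.1.2, h.2⟩

@[simp]
theorem runs_seq {P R : Prog} : Runs W (Prog.seq P R) s Q ↔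
    Runs W P s fun s₁ t₁ => Runs W R s₁ fun s₂ t₂ => Q s₂ (t₁ + t₂) := by
  constructor
  · rintro ⟨s', t, he, hq⟩
    cases he with
    | seq h1 h2 => exact ⟨_, _, h1, _, _, h2, hq⟩
  · rintro ⟨s₁, t₁, h1, s₂, t₂, h2, hq⟩
    exact ⟨_, _, Exec.seq h1 h2, hq⟩

@[simp]
theorem runs_ite {b : Test} {P R : Prog} : Runs W (Prog.ite b P R) s Q ↔ b.Ok W s ∧
    (b.eval s → Runs W P s fun s' t => Q s' (b.cost + t)) ∧
    (¬ b.eval s → Runs W R s fun s' t => Q s' (b.cost + t)) := by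
  constructor
  · rintro ⟨s', t, he, hq⟩
    cases he with
    | ite_true hb h hP => exact ⟨hb, fun _ => ⟨_, _, hP, hq⟩, fun h' => absurd h h'⟩
    | ite_false hb h hP => exact ⟨hb, fun h' => absurd h' h, fun _ => ⟨_, _, hP, hq⟩⟩
  · rintro ⟨hb, h1, h2⟩
    by_cases h : b.eval s
    · obtain ⟨s', t, he, hq⟩ := h1 h
      exact ⟨_, _, Exec.ite_true hb h he, hq⟩
    · obtain ⟨s', t, he, hq⟩ := h2 h
      exact ⟨_, _, Exec.ite_false hb h he, hq⟩

theorem Test.cost_pos (b : Test) : 0 < b.cost := by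
  cases b <;> simp [Test.cost]

/-- Total correctness of a loop with the invariant `I` whose running time is paid for by the
potential `Φ`. -/
theorem Runs.loop {b : Test} {P : Prog} (I : State → Prop) (Φ : State → ℕ)
    (hstep : ∀ s, I s → b.Ok W s ∧
      (b.eval s → Runs W P s fun s' t => I s' ∧ b.cost + t + Φ s' ≤ Φ s)) (hs : I s) :
    Runs W (Prog.loop b P) s fun s' t => I s' ∧ ¬ b.eval s' ∧ t + Φ s' ≤ Φ s + b.cost := by
  induction hk : Φ s using Nat.strong_induction_on generalizing s with
  | _ k ih =>
    subst hk
    obtain ⟨hok, hbody⟩ := hstep s hs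
    by_cases hb : b.eval s
    · obtain ⟨s₁, t₁, he, hI, ht⟩ := hbody hb
      have := b.cost_pos
      obtain ⟨s₂, t₂, he₂, hI₂, hb₂, ht₂⟩ := ih (Φ s₁) (by omega) hI rfl
      exact ⟨_, _, Exec.loop_true hok hb he he₂, hI₂, hb₂, by omega⟩
    · exact ⟨_, _, Exec.loop_false hok hb, hs, hb, by omega⟩

end RealRAM

/-! # Rotating calipers -/

namespace RealRAM

infixr:60 " ;; " => Prog.seq

/-- Appends a copy of the stored cyclic list, and its first element once more. -/
def unrollProg : Prog :=
  .iset 1 (.const 0) ;;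
  .loop (.ilt (.reg 1) (.add (.reg 0) (.const 1)))
    (.rput 0 (.add (.reg 0) (.reg 1)) (.get 0 (.reg 1)) ;;
     .rput 1 (.add (.reg 0) (.reg 1)) (.get 1 (.reg 1)) ;;
     .iset 1 (.add (.reg 1) (.const 1)))

/-- The calipers use edges `i < h` and vertices up to `i + h`, and they look one vertex ahead; the
entries `0, …, 2 * h` make reductions modulo `h` unnecessary. The last copy, for `k = h`, reads an
entry that the loop itself has written. -/
theorem runs_unrollProg {W h : ℕ} {w : ℕ → Plane} (hw : IsPeriodicPolygon h w) (hW : 10 * h ≤ W)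
    {s : State} (hs : s.ireg 0 = h) (ha : ∀ k < h, s.rarr 0 k = w k 0 ∧ s.rarr 1 k = w k 1) :
    Runs W unrollProg s fun s' t => s'.ireg 0 = h ∧
      (∀ k ≤ 2 * h, s'.rarr 0 k = w k 0 ∧ s'.rarr 1 k = w k 1) ∧ t ≤ 100 * h := by
  have h2 := hw.two_le
  unfold unrollProg
  rw [runs_seq, runs_iset]
  refine ⟨by simp [IExpr.Ok], ?_⟩
  refine (Runs.loop (fun s => s.ireg 0 = h ∧ s.ireg 1 ≤ h + 1 ∧
    ∀ k < h + s.ireg 1, s.rarr 0 k = w k 0 ∧ s.rarr 1 k = w k 1)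
    (fun s => 30 * (h + 1 - s.ireg 1)) ?_ ?_).mono ?_
  · rintro s ⟨hn, hk, ha⟩
    simp [Function.update_apply]
    generalize s.ireg 0 = n at *
    generalize s.ireg 1 = k at *
    subst hn
    refine ⟨by omega, fun hk => ⟨by omega, by omega, ⟨rfl, hk, fun i hi => ?_⟩, by omega⟩⟩
    split_ifs with hi'
    · have := ha k (by omega)
      rw [hi', add_comm n k, hw.periodic]
      exact this
    · exact ha i (by omega)
  · simpa [hs] using ha
  · rintro s' t ⟨⟨hn, hk, ha⟩, hb, ht⟩
    simp at hb ht
    refine ⟨hn, fun k hk' => ha k (by omega), ?_⟩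
    simp only [IExpr.cost]
    omega

/-- The registers `0`, `1`, `2`, `3` describe the best one among the first `i` edges. -/
def BestEdge (w : ℕ → Plane) (i : ℕ) (r : ℕ → ℝ) : Prop :=
  ∃ i₀ j₀, IsFarthest w i₀ j₀ ∧ r 0 = edgeNormal w i₀ 0 ∧ r 1 = edgeNormal w i₀ 1 ∧
    r 2 = (inner ℝ (edgeNormal w i₀) (w i₀) + inner ℝ (edgeNormal w i₀) (w j₀)) / 2 ∧
    r 3 = sqHeight w i₀ j₀ ∧ ∀ i' < i, ∃ j', sqHeight w i₀ j₀ ≤ sqHeight w i' j'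

/-- Keeps the better one of the best edge so far and the current one. -/
def keepBestProg : Prog :=
  .rset 6 (.sub (.mul (.reg 4) (.sub (.get 1 (.reg 2)) (.get 1 (.reg 1))))
    (.mul (.reg 5) (.sub (.get 0 (.reg 2)) (.get 0 (.reg 1))))) ;;
  .rset 6 (.div (.mul (.reg 6) (.reg 6)) (.add (.mul (.reg 5) (.reg 5)) (.mul (.reg 4) (.reg 4)))) ;;
  .ite (.and (.not (.rlt (.reg 3) (.const 0))) (.not (.rlt (.reg 6) (.reg 3)))) .skip
    (.rset 3 (.reg 6) ;;
     .rset 0 (.sub (.const 0) (.reg 5)) ;;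
     .rset 1 (.reg 4) ;;
     .rset 2 (.div (.sub (.mul (.reg 4) (.add (.get 1 (.reg 1)) (.get 1 (.reg 2))))
       (.mul (.reg 5) (.add (.get 0 (.reg 1)) (.get 0 (.reg 2))))) (.const 2)))

theorem sqHeight_nonneg (w : ℕ → Plane) (i j : ℕ) : 0 ≤ sqHeight w i j := by
  unfold sqHeight
  positivity

/-- A negative register `3` means that no edge has been recorded yet; genuine squared heights are
nonnegative. Registers `4` and `5` hold the edge vector, which is the edge normal rotated back. -/
theorem runs_keepBestProg {W h : ℕ} {w : ℕ → Plane} (hw : IsPeriodicPolygon h w) {s : State}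
    {i j : ℕ} (hi : s.ireg 1 = i) (hj : s.ireg 2 = j) (hiW : i ≤ W) (hjW : j ≤ W)
    (hai : s.rarr 0 i = w i 0 ∧ s.rarr 1 i = w i 1) (haj : s.rarr 0 j = w j 0 ∧ s.rarr 1 j = w j 1)
    (h4 : s.rreg 4 = edgeNormal w i 1) (h5 : s.rreg 5 = -edgeNormal w i 0)
    (hfar : IsFarthest w i j) (hbest : i = 0 ∧ s.rreg 3 < 0 ∨ BestEdge w i s.rreg) :
    Runs W keepBestProg s fun s' t => s'.ireg = s.ireg ∧ s'.rarr = s.rarr ∧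
      BestEdge w (i + 1) s'.rreg ∧ t ≤ 100 := by
  have hq : ((edgeNormal w i 1 * (w j 1 - w i 1) + edgeNormal w i 0 * (w j 0 - w i 0)) *
      (edgeNormal w i 1 * (w j 1 - w i 1) + edgeNormal w i 0 * (w j 0 - w i 0))) /
      (edgeNormal w i 0 * edgeNormal w i 0 + edgeNormal w i 1 * edgeNormal w i 1) =
      sqHeight w i j := by
    rw [sqHeight, ← inner_edgeNormal_sub, Plane.inner_eq, Plane.inner_eq]
    congr 1 <;> ring
  have hne : edgeNormal w i 0 * edgeNormal w i 0 + edgeNormal w i 1 * edgeNormal w i 1 ≠ 0 := by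
    intro h0
    refine hw.edgeNormal_ne_zero i (Plane.ext_coord ?_ ?_)
    · simp only [PiLp.zero_apply]
      nlinarith [mul_self_nonneg (edgeNormal w i 0), mul_self_nonneg (edgeNormal w i 1)]
    · simp only [PiLp.zero_apply]
      nlinarith [mul_self_nonneg (edgeNormal w i 0), mul_self_nonneg (edgeNormal w i 1)]
  unfold keepBestProg
  simp [hi, hj, h4, h5, hai, haj, hiW, hjW, hq, hne]
  constructor
  · intro h3 hle
    have hb := hbest.resolve_left fun h => absurd h.2 (not_lt.2 h3)
    obtain ⟨i₀, j₀, b1, b2, b3, b4, b5, b6⟩ := hb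
    refine ⟨i₀, j₀, b1, by simp [b2], by simp [b3], by simp [b4], by simp [b5], fun i' hi' => ?_⟩
    rcases (Nat.lt_succ_iff_lt_or_eq.1 hi') with h | rfl
    · exact b6 i' h
    · exact ⟨j, b5 ▸ hle⟩
  · intro hlt
    refine ⟨i, j, hfar, by simp, by simp, ?_, by simp, fun i' hi' => ?_⟩
    · simp [Plane.inner_eq]
      ring
    · rcases (Nat.lt_succ_iff_lt_or_eq.1 hi') with h | rfl
      · obtain ⟨h3, -⟩ | ⟨i₀, j₀, b1, b2, b3, b4, b5, b6⟩ := hbest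
        · omega
        · obtain ⟨j', hj'⟩ := b6 i' h
          have := hlt (b5 ▸ sqHeight_nonneg w i₀ j₀)
          exact ⟨j', by linarith⟩
      · exact ⟨j, le_rfl⟩

/-- One step of the rotating calipers: the pair of the edge `i` and the vertex `j` advances. -/
def calipersStepProg : Prog :=
  .rset 4 (.sub (.get 0 (.add (.reg 1) (.const 1))) (.get 0 (.reg 1))) ;;
  .rset 5 (.sub (.get 1 (.add (.reg 1) (.const 1))) (.get 1 (.reg 1))) ;;
  .ite (.rlt (.const 0)
      (.sub (.mul (.reg 4) (.sub (.get 1 (.add (.reg 2) (.const 1))) (.get 1 (.reg 2))))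
        (.mul (.reg 5) (.sub (.get 0 (.add (.reg 2) (.const 1))) (.get 0 (.reg 2))))))
    (.iset 2 (.add (.reg 2) (.const 1)))
    (keepBestProg ;; .iset 1 (.add (.reg 1) (.const 1)))

/-- The invariant of the rotating calipers. -/
structure CalipersInv (h : ℕ) (w : ℕ → Plane) (s : State) : Prop where
  reg_zero : s.ireg 0 = h
  arr_eq : ∀ k ≤ 2 * h, s.rarr 0 k = w k 0 ∧ s.rarr 1 k = w k 1
  edge_le : s.ireg 1 ≤ h
  one_le : 1 ≤ s.ireg 2
  le_add : s.ireg 2 ≤ s.ireg 1 + h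
  ahead : h = 2 ∨ s.ireg 1 + 1 ≤ s.ireg 2 ∧ 0 ≤ turn w (s.ireg 1) (s.ireg 2 - 1)
  best : s.ireg 1 = 0 ∧ s.rreg 3 < 0 ∨ BestEdge w (s.ireg 1) s.rreg

/-- Every step advances the vertex or the edge, and both pointers are bounded, so the potential is
the number of moves left, weighted by `200`. The vertex advances while the height above the current
edge increases. When it stops, it is farthest; `turn_succ_nonneg` carries the ascent condition over
to the next edge. -/
theorem runs_calipersStepProg {W h : ℕ} {w : ℕ → Plane} (hw : IsPeriodicPolygon h w)
    (hW : 10 * h ≤ W) (s : State) (hs : CalipersInv h w s) (hb : s.ireg 1 < h) :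
    Runs W calipersStepProg s fun s' t => CalipersInv h w s' ∧
      3 + t + 200 * ((h - s'.ireg 1) + (2 * h - s'.ireg 2)) ≤
        200 * ((h - s.ireg 1) + (2 * h - s.ireg 2)) := by
  obtain ⟨h0, ha, h1, h2, h3, h4, h5⟩ := hs
  obtain ⟨i, hi⟩ : ∃ i, s.ireg 1 = i := ⟨_, rfl⟩
  obtain ⟨j, hj⟩ : ∃ j, s.ireg 2 = j + 1 := ⟨s.ireg 2 - 1, by omega⟩
  rw [hi] at h1 h3 h4 h5 hb
  rw [hj] at h3 h4
  simp only [Nat.add_sub_cancel] at h4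
  have a1 := ha i (by omega)
  have a2 := ha (i + 1) (by omega)
  have a3 := ha (j + 1) (by omega)
  have a4 := ha (j + 1 + 1) (by omega)
  have hturn : turn w i (j + 1) = (w (i + 1) 0 - w i 0) * (w (j + 1 + 1) 1 - w (j + 1) 1) -
      (w (i + 1) 1 - w i 1) * (w (j + 1 + 1) 0 - w (j + 1) 0) := by
    simp only [turn, inner_edgeNormal]
    ring
  unfold calipersStepProg
  simp [hi, hj, a1, a2, a3, a4]
  refine ⟨by omega, by omega, fun hlt => ⟨by omega, ?_, by omega⟩, fun hle => ?_⟩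
  · have hpos : 0 < turn w i (j + 1) := by rw [hturn]; linarith
    -- At `i + h` the pointer would be back at the start of edge `i`, where the turn is `0` and not
    -- positive; so advancing preserves `le_add`.
    have hne : j + 1 ≠ i + h := by
      intro heq
      have : turn w i (j + 1) = turn w i i := by
        simp only [turn]
        rw [heq, hw.periodic, show i + h + 1 = i + 1 + h by ring, hw.periodic]
      rw [this, turn_self] at hpos
      exact lt_irrefl _ hpos
    refine ⟨by simpa using h0, ha, by simpa [hi] using h1, by simp, by simp [hi]; omega, ?_, ?_⟩
    · simp [hi]
      rcases h4 with h4 | ⟨h4, -⟩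
      · exact Or.inl h4
      · exact Or.inr ⟨by omega, hpos.le⟩
    · simpa [hi, BestEdge] using h5
  · have hneg : turn w i (j + 1) ≤ 0 := by rw [hturn]; linarith
    refine Runs.mono (runs_keepBestProg hw (i := i) (j := j + 1) (by simp [hi]) (by simp [hj]) (by omega)
      (by omega) a1 a3 (by simp [edgeNormal]) (by simp [edgeNormal])
      (hw.isFarthest (h4.imp id And.right) hneg) (by simpa [BestEdge] using h5)) ?_
    rintro s' t ⟨e1, e2, hbest, ht⟩
    simp [e1, hi, hj]
    refine ⟨by omega, ⟨by simpa [e1] using h0, by simpa [e2] using ha, by simp; omega, by simp [hj],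
      by simp [hj]; omega, ?_, by simpa using hbest⟩, by omega⟩
    simp [hj]
    by_cases hh : h = 2
    · exact Or.inl hh
    · obtain ⟨h6, h7⟩ := h4.resolve_left hh
      -- Were the pointer `j + 1` still at the end `i + 1` of the edge, the next turn would be
      -- positive and the vertex would have advanced instead.
      have hne : i ≠ j := by
        rintro rfl
        exact absurd (hw.turn_succ_pos hh i) (not_lt.2 hneg)
      exact Or.inr ⟨by omega, hw.turn_succ_nonneg hh (by omega) (by omega) h7⟩

/-- Rotating calipers. -/
def calipersProg : Prog :=
  unrollProg ;; .iset 1 (.const 0) ;; .iset 2 (.const 1) ;; .rset 3 (.const (-1)) ;;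
  .loop (.ilt (.reg 1) (.reg 0)) calipersStepProg

theorem runs_calipersProg_aux {W h : ℕ} {w : ℕ → Plane} (hw : IsPeriodicPolygon h w)
    (hW : 10 * h ≤ W) {s : State} (hs : s.ireg 0 = h)
    (ha : ∀ k < h, s.rarr 0 k = w k 0 ∧ s.rarr 1 k = w k 1) :
    Runs W calipersProg s fun s' t => BestEdge w h s'.rreg ∧ t ≤ 1000 * h := by
  have h2 := hw.two_le
  unfold calipersProg
  rw [runs_seq]
  refine (runs_unrollProg hw hW hs ha).mono ?_
  rintro s₁ t₁ ⟨hn, ha, ht⟩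
  simp
  refine ⟨by omega, (Runs.loop (CalipersInv h w)
    (fun s => 200 * ((h - s.ireg 1) + (2 * h - s.ireg 2))) ?_ ?_).mono ?_⟩
  · intro s hs
    have e1 := hs.reg_zero
    have e2 := hs.edge_le
    refine ⟨by simp; omega, fun hb => runs_calipersStepProg hw hW s hs ?_⟩
    simpa [e1] using hb
  · refine ⟨by simpa using hn, ha, by simp, by simp, by simp; omega, ?_, by simp⟩
    simp [turn_self]
  · rintro s' t ⟨hs', hb, ht'⟩
    have e1 := hs'.reg_zero
    have e2 := hs'.edge_le
    simp [e1] at hb ht'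
    have e3 : s'.ireg 1 = h := le_antisymm e2 hb
    refine ⟨?_, by omega⟩
    have := hs'.best
    rw [e3] at this
    exact this.resolve_left fun h => by omega

theorem runs_calipersProg {W h : ℕ} {v : Fin h → Plane} {S : Set Plane} (hS : S.Finite)
    (hne : S.Nontrivial) (hv : IsConvexHullCycle v S) (hW : 10 * h ≤ W) {s : State}
    (hs : s.Holds v) :
    Runs W calipersProg s fun s' t => t ≤ 1000 * h ∧
      ∃ T : Strip, T.IsSmallestEnclosing S ∧ s'.outputLine = T.midline := by
  have h2 := hv.two_le hS hne
  have hw := hv.isPeriodicPolygon h2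
  set w : ℕ → Plane := fun k => v ⟨k % h, Nat.mod_lt k (by omega)⟩ with hwdef
  have hrange : Set.range w = Set.range v := by
    ext x
    constructor
    · rintro ⟨k, rfl⟩
      exact ⟨_, rfl⟩
    · rintro ⟨k, rfl⟩
      refine ⟨k, ?_⟩
      simp only [hwdef, Nat.mod_eq_of_lt k.2]
  refine (runs_calipersProg_aux hw hW hs.1 fun k hk => ?_).mono ?_
  · simp only [hwdef, Nat.mod_eq_of_lt hk]
    exact hs.2 ⟨k, hk⟩
  · rintro s' t ⟨⟨i, j, b1, b2, b3, b4, b5, b6⟩, ht⟩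
    refine ⟨ht, hw.edgeStrip i j, ?_, ?_⟩
    · rw [← Strip.isSmallestEnclosing_congr (hv.convexHull_eq hS), ← hrange]
      exact hw.isSmallestEnclosing_edgeStrip b1 b6
    · rw [IsPeriodicPolygon.edgeStrip, Strip.midline_ofNormal, State.outputLine, b2, b3, b4]
      congr 1

end RealRAM

/-! # Merge sort -/

theorem Nat.div_eq_div_of_mem_block {w lo x : ℕ} (hw : 0 < w) (hd : w ∣ lo) (h1 : lo ≤ x)
    (h2 : x < lo + w) : x / w = lo / w := by
  obtain ⟨q, rfl⟩ := hd
  rw [Nat.mul_div_cancel_left _ hw]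
  exact Nat.div_eq_of_lt_le (by rwa [mul_comm]) (by rw [mul_comm, Nat.mul_succ]; exact h2)

theorem Nat.le_of_div_eq_of_dvd {w lo x y : ℕ} (hd : w ∣ lo) (h : x / w = y / w)
    (hy : lo ≤ y) : lo ≤ x := by
  have h1 : lo / w ≤ x / w := h ▸ Nat.div_le_div_right hy
  calc lo = w * (lo / w) := (Nat.mul_div_cancel' hd).symm
    _ ≤ w * (x / w) := Nat.mul_le_mul_left _ h1
    _ ≤ x := Nat.mul_div_le x w

/-- The blocks of length `w` of the first `n` entries of `a` are sorted. -/
def BlockSorted {α : Type*} [LinearOrder α] (a : ℕ → α) (n w : ℕ) : Prop :=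
  ∀ x y, x ≤ y → y < n → x / w = y / w → a x ≤ a y

/-- Invariant of merging adjacent sorted blocks of length `w` of `a` into blocks of `b`. The blocks
`[lo, mid)` and `[mid, hi)` are being merged, `i` and `j` point to their first entries that have not
been written, and `k` is the next position to be written. -/
structure MergeInv {α : Type*} [LinearOrder α] (S : Set α) (a : ℕ → α) (n w : ℕ) (b : ℕ → α)
    (k i mid j hi lo : ℕ) : Prop where
  dvd : 2 * w ∣ lo
  lo_le : lo ≤ i
  i_le : i ≤ mid
  mid_le : mid ≤ j
  j_le : j ≤ hi
  mid_eq : mid = min (lo + w) n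
  hi_eq : hi = min (lo + 2 * w) n
  k_eq : k + mid = i + j
  sorted : BlockSorted b k (2 * w)
  le_left : ∀ x y, lo ≤ x → x < k → i ≤ y → y < mid → b x ≤ a y
  le_right : ∀ x y, lo ≤ x → x < k → j ≤ y → y < hi → b x ≤ a y
  -- Only the set of values is tracked; `exists_sorted_of_key` later recovers distinctness by
  -- counting. The last interval ends at `n` and not at `hi`, so that it includes the blocks still
  -- to be merged.
  set_eq : b '' Set.Iio k ∪ a '' Set.Ico i mid ∪ a '' Set.Ico j n = S

theorem image_update_Iio_succ {α : Type*} (b : ℕ → α) (k : ℕ) (c : α) :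
    Function.update b k c '' Set.Iio (k + 1) = insert c (b '' Set.Iio k) := by
  ext z
  simp only [Set.mem_image, Set.mem_Iio, Set.mem_insert_iff]
  constructor
  · rintro ⟨x, hx, rfl⟩
    rcases Nat.lt_succ_iff_lt_or_eq.1 hx with h | rfl
    · exact Or.inr ⟨x, h, (Function.update_of_ne h.ne _ _).symm⟩
    · exact Or.inl (Function.update_self _ _ _)
  · rintro (rfl | ⟨x, hx, rfl⟩)
    · exact ⟨k, by omega, Function.update_self _ _ _⟩
    · exact ⟨x, by omega, Function.update_of_ne hx.ne _ _⟩

theorem image_Ico_eq_insert {α : Type*} (a : ℕ → α) {i m : ℕ} (h : i < m) :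
    a '' Set.Ico i m = insert (a i) (a '' Set.Ico (i + 1) m) := by
  rw [← Set.image_insert_eq]
  congr 1
  ext x
  simp only [Set.mem_Ico, Set.mem_insert_iff]
  omega

namespace MergeInv

variable {α : Type*} [LinearOrder α] {S : Set α} {a b : ℕ → α} {n w k i mid j hi lo : ℕ}

theorem blockSorted_update (h : MergeInv S a n w b k i mid j hi lo) {c : α}
    (hc : ∀ x, lo ≤ x → x < k → b x ≤ c) :
    BlockSorted (Function.update b k c) (k + 1) (2 * w) := by
  intro x y hxy hy hd
  rcases Nat.lt_succ_iff_lt_or_eq.1 hy with hy' | rfl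
  · rw [Function.update_of_ne (by omega), Function.update_of_ne (by omega)]
    exact h.sorted x y hxy hy' hd
  · rcases hxy.eq_or_lt with rfl | hlt
    · exact le_rfl
    · rw [Function.update_self, Function.update_of_ne hlt.ne]
      have h1 := h.k_eq
      have h2 := h.lo_le
      have h3 := h.mid_le
      exact hc x (Nat.le_of_div_eq_of_dvd h.dvd hd (by omega)) hlt

theorem le_of_update {k : ℕ} {c d : α} {x : ℕ} (hlo : lo ≤ x) (hx : x < k + 1)
    (hb : ∀ x, lo ≤ x → x < k → b x ≤ d) (hc : c ≤ d) : Function.update b k c x ≤ d := by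
  rcases Nat.lt_succ_iff_lt_or_eq.1 hx with hx' | rfl
  · rw [Function.update_of_ne hx'.ne]
    exact hb x hlo hx'
  · rwa [Function.update_self]

/-- The entry `a i` is least among what is left of both blocks: the blocks of `a` are sorted, and
`hle` compares their heads. If the right block is exhausted, no comparison is needed. -/
theorem take_left (h : MergeInv S a n w b k i mid j hi lo) (hw : 0 < w) (ha : BlockSorted a n w)
    (hi' : i < mid) (hle : j < hi → a i ≤ a j) :
    MergeInv S a n w (Function.update b k (a i)) (k + 1) (i + 1) mid j hi lo := by
  obtain ⟨h1, h2, h3, h4, h5, h6, h7, h8, h9, h10, h11, h12⟩ := h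
  have hd : w ∣ lo := (Dvd.intro_left 2 rfl).trans h1
  refine ⟨h1, by omega, by omega, h4, h5, h6, h7, by omega, ?_, ?_, ?_, ?_⟩
  · exact blockSorted_update ⟨h1, h2, h3, h4, h5, h6, h7, h8, h9, h10, h11, h12⟩
      fun x hx hk => h10 x i hx hk le_rfl hi'
  · intro x y hx hk hy hy'
    refine le_of_update hx hk (fun x hx hk => h10 x y hx hk (by omega) hy') ?_
    refine ha i y (by omega) (by omega) ?_
    exact (Nat.div_eq_div_of_mem_block hw hd h2 (by omega)).trans
      (Nat.div_eq_div_of_mem_block hw hd (by omega) (by omega)).symm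
  · intro x y hx hk hy hy'
    refine le_of_update hx hk (fun x hx hk => h11 x y hx hk hy hy') ((hle (by omega)).trans ?_)
    have hd' : w ∣ lo + w := hd.add (dvd_refl w)
    refine ha j y (by omega) (by omega) ?_
    exact (Nat.div_eq_div_of_mem_block hw hd' (by omega) (by omega)).trans
      (Nat.div_eq_div_of_mem_block hw hd' (by omega) (by omega)).symm
  · rw [image_update_Iio_succ, ← h12, image_Ico_eq_insert a hi']
    simp only [Set.insert_union, Set.union_insert]

theorem take_right (h : MergeInv S a n w b k i mid j hi lo) (hw : 0 < w) (ha : BlockSorted a n w)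
    (hj' : j < hi) (hle : i < mid → a j ≤ a i) :
    MergeInv S a n w (Function.update b k (a j)) (k + 1) i mid (j + 1) hi lo := by
  obtain ⟨h1, h2, h3, h4, h5, h6, h7, h8, h9, h10, h11, h12⟩ := h
  have hd : w ∣ lo := (Dvd.intro_left 2 rfl).trans h1
  refine ⟨h1, by omega, by omega, by omega, by omega, h6, h7, by omega, ?_, ?_, ?_, ?_⟩
  · exact blockSorted_update ⟨h1, h2, h3, h4, h5, h6, h7, h8, h9, h10, h11, h12⟩
      fun x hx hk => h11 x j hx hk le_rfl hj'
  · intro x y hx hk hy hy'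
    refine le_of_update hx hk (fun x hx hk => h10 x y hx hk hy hy') ((hle (by omega)).trans ?_)
    refine ha i y (by omega) (by omega) ?_
    exact (Nat.div_eq_div_of_mem_block hw hd h2 (by omega)).trans
      (Nat.div_eq_div_of_mem_block hw hd (by omega) (by omega)).symm
  · intro x y hx hk hy hy'
    refine le_of_update hx hk (fun x hx hk => h11 x y hx hk (by omega) hy') ?_
    have hd' : w ∣ lo + w := hd.add (dvd_refl w)
    refine ha j y (by omega) (by omega) ?_
    exact (Nat.div_eq_div_of_mem_block hw hd' (by omega) (by omega)).trans
      (Nat.div_eq_div_of_mem_block hw hd' (by omega) (by omega)).symm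
  · rw [image_update_Iio_succ, ← h12, image_Ico_eq_insert a (show j < n by omega)]
    simp only [Set.insert_union, Set.union_insert]

theorem next_block (h : MergeInv S a n w b k i mid j hi lo) (hi' : mid ≤ i) (hj' : hi ≤ j)
    (hk : k < n) :
    MergeInv S a n w b k hi (min (hi + w) n) (min (hi + w) n) (min (hi + 2 * w) n) hi := by
  obtain ⟨h1, h2, h3, h4, h5, h6, h7, h8, h9, h10, h11, h12⟩ := h
  -- Both blocks are used up, so `k = hi`; as `k < n`, the minimum that defines `hi` is not cut off
  -- at `n`, and the next block starts at a multiple of `2 * w`.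
  have e1 : hi = lo + 2 * w := by omega
  have e2 : k = hi := by omega
  have e3 : i = mid := by omega
  have e4 : j = hi := by omega
  refine ⟨e1 ▸ h1.add (dvd_refl _), le_rfl, by omega, le_rfl, by omega, rfl, rfl, by omega, h9,
    fun x y hx hk => by omega, fun x y hx hk => by omega, ?_⟩
  rw [← h12, e3, e4, Set.Ico_self, Set.image_empty, Set.union_empty, Set.union_assoc,
    ← Set.image_union, Set.Ico_union_Ico_eq_Ico (by omega) (by omega)]

theorem init (hw : 0 < w) (hwn : w < n) (hS : a '' Set.Iio n = S) :
    MergeInv S a n w b 0 0 w w (min (w + w) n) 0 := by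
  refine ⟨dvd_zero _, le_rfl, hw.le, le_rfl, by omega, by omega, by omega, by omega,
    fun x y _ hy => by omega, fun x y _ hy => by omega, fun x y _ hy => by omega, ?_⟩
  rw [← hS, Set.union_assoc, ← Set.image_union, Set.Ico_union_Ico_eq_Ico hw.le hwn.le]
  have : Set.Iio 0 = (∅ : Set ℕ) := by ext; simp
  rw [this, Set.image_empty, Set.empty_union]
  congr 1
  ext
  simp

theorem final (h : MergeInv S a n w b k i mid j hi lo) (hk : n ≤ k) :
    BlockSorted b n (2 * w) ∧ b '' Set.Iio n = S := by
  obtain ⟨h1, h2, h3, h4, h5, h6, h7, h8, h9, h10, h11, h12⟩ := h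
  have e1 : k = n := by omega
  have e2 : i = mid := by omega
  have e3 : j = n := by omega
  subst e1 e2 e3
  refine ⟨h9, ?_⟩
  simpa using h12

end MergeInv

namespace RealRAM

/-- The `k`-th point that is stored in the arrays `A` and `B`; points are compared
lexicographically. -/
def State.key (s : State) (A B : ℕ) : ℕ → ℝ ×ₗ ℝ := fun k => toLex (s.rarr A k, s.rarr B k)

theorem State.key_eq (s : State) (A B : ℕ) :
    s.key A B = fun k => toLex (s.rarr A k, s.rarr B k) := rfl

/-- Compares the points whose numbers are in the registers `x` and `y`. -/
def lexLtTest (x y : ℕ) : Test :=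
  .not (.and (.not (.rlt (.get 0 (.reg x)) (.get 0 (.reg y))))
    (.not (.and (.not (.rlt (.get 0 (.reg y)) (.get 0 (.reg x))))
      (.rlt (.get 1 (.reg x)) (.get 1 (.reg y))))))

/-- Tests have no disjunction, so it is written by De Morgan; once the first coordinates fail to
increase, the negated reverse comparison expresses their equality. -/
theorem eval_lexLtTest (s : State) (x y : ℕ) :
    (lexLtTest x y).eval s ↔ s.key 0 1 (s.ireg x) < s.key 0 1 (s.ireg y) := by
  simp only [lexLtTest, State.key_eq, Prod.Lex.toLex_lt_toLex, Test.eval, RExpr.eval, IExpr.eval]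
  constructor
  · intro h
    by_contra! hcon
    exact h ⟨not_lt.2 hcon.1, fun h' => absurd h'.2
      (not_lt.2 (hcon.2 (le_antisymm (not_lt.1 h'.1) hcon.1)))⟩
  · rintro (h | ⟨h1, h2⟩) ⟨h3, h4⟩
    · exact h3 h
    · exact h4 ⟨by rw [h1]; exact lt_irrefl _, h2⟩

theorem ok_lexLtTest {W : ℕ} {s : State} {x y : ℕ} (hx : s.ireg x ≤ W) (hy : s.ireg y ≤ W) :
    (lexLtTest x y).Ok W s := by
  simp [lexLtTest, hx, hy]

theorem cost_lexLtTest (x y : ℕ) : (lexLtTest x y).cost = 21 := rfl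

/-- Appends the point whose number is in register `x` to the output of the merging. -/
def takeProg (x : ℕ) : Prog :=
  .rput 2 (.reg 2) (.get 0 (.reg x)) ;; .rput 3 (.reg 2) (.get 1 (.reg x)) ;;
  .iset x (.add (.reg x) (.const 1)) ;; .iset 2 (.add (.reg 2) (.const 1))

/-- Merging: one step. -/
def mergeStepProg : Prog :=
  .ite (.and (.ilt (.reg 3) (.reg 4)) (.not (.and (.ilt (.reg 5) (.reg 6)) (lexLtTest 5 3))))
    (takeProg 3)
    (.ite (.ilt (.reg 5) (.reg 6)) (takeProg 5)
      (.iset 3 (.reg 6) ;;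
       .iset 4 (.sub (.reg 0) (.sub (.reg 0) (.add (.reg 3) (.reg 1)))) ;;
       .iset 5 (.reg 4) ;;
       .iset 6 (.sub (.reg 0) (.sub (.reg 0) (.add (.reg 3) (.add (.reg 1) (.reg 1)))))))

/-- The state of the merging. -/
def MergeState (S : Set (ℝ ×ₗ ℝ)) (n w : ℕ) (s : State) : Prop :=
  s.ireg 0 = n ∧ s.ireg 1 = w ∧ BlockSorted (s.key 0 1) n w ∧ ∃ lo,
    MergeInv S (s.key 0 1) n w (s.key 2 3) (s.ireg 2) (s.ireg 3) (s.ireg 4) (s.ireg 5) (s.ireg 6) lo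

theorem key_update_take (s : State) (k x : ℕ) (f : ℕ → ℕ) :
    ({ s with
        ireg := f
        rarr := Function.update (Function.update s.rarr 2
          (Function.update (s.rarr 2) k (s.rarr 0 x))) 3
          (Function.update (s.rarr 3) k (s.rarr 1 x)) } : State).key 2 3 =
      Function.update (s.key 2 3) k (s.key 0 1 x) := by
  funext y
  by_cases h : y = k
  · subst h
    simp [State.key_eq]
  · simp [State.key_eq, h]

/-- A step either writes an entry, which raises `k`, or moves to the next pair of blocks, which
raises `hi` because `k < n`; the potential counts both. -/
theorem runs_mergeStepProg {W n w : ℕ} {S : Set (ℝ ×ₗ ℝ)} (hw : 0 < w) (hwn : w < n)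
    (hW : 10 * n ≤ W) {s : State} (hs : MergeState S n w s) (hk : s.ireg 2 < n) :
    Runs W mergeStepProg s fun s' t => MergeState S n w s' ∧
      3 + t + 100 * ((n - s'.ireg 2) + (n - s'.ireg 6)) ≤
        100 * ((n - s.ireg 2) + (n - s.ireg 6)) := by
  obtain ⟨h0, h1, ha, lo, hM⟩ := hs
  have hM' := hM
  obtain ⟨-, -, g3, g4, g5, g6, g7, g8, -⟩ := hM'
  unfold mergeStepProg
  rw [runs_ite]
  refine ⟨⟨by simp; omega, fun _ => ⟨by simp; omega, fun _ => ok_lexLtTest (by omega) (by omega)⟩⟩,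
    fun ht => ?_, fun ht => ?_⟩
  · simp [takeProg, cost_lexLtTest]
    simp [eval_lexLtTest] at ht
    refine ⟨by omega, by omega, by omega, ⟨by simpa using h0, by simpa using h1, ?_, lo, ?_⟩,
      by omega⟩
    · simpa [State.key_eq] using ha
    · simp only [key_update_take]
      simpa [State.key_eq] using hM.take_left hw ha ht.1 ht.2
  · rw [runs_ite]
    simp only [Test.eval, IExpr.eval, eval_lexLtTest] at ht
    refine ⟨by simp; omega, fun hj => ?_, fun hj => ?_⟩
    · simp [takeProg, cost_lexLtTest]
      simp only [Test.eval, IExpr.eval] at hj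
      refine ⟨by omega, by omega, by omega, ⟨by simpa using h0, by simpa using h1, ?_, lo, ?_⟩,
        by omega⟩
      · simpa [State.key_eq] using ha
      · simp only [key_update_take]
        have : s.ireg 3 < s.ireg 4 → s.key 0 1 (s.ireg 5) ≤ s.key 0 1 (s.ireg 3) := by
          intro h
          by_contra! hcon
          exact ht ⟨h, fun h' => lt_asymm h'.2 hcon⟩
        simpa [State.key_eq] using hM.take_right hw ha hj this
    · simp only [Test.eval, IExpr.eval] at hj
      have hi : s.ireg 4 ≤ s.ireg 3 := by
        by_contra! hcon
        exact ht ⟨hcon, fun h' => hj h'.1⟩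
      have hN := hM.next_block hi (not_lt.1 hj) hk
      simp [cost_lexLtTest]
      -- With truncated subtraction, `a - (a - b)` is the minimum of `a` and `b`.
      have e1 : s.ireg 0 - (s.ireg 0 - (s.ireg 6 + s.ireg 1)) = min (s.ireg 6 + w) n := by omega
      have e2 : s.ireg 0 - (s.ireg 0 - (s.ireg 6 + (s.ireg 1 + s.ireg 1))) =
        min (s.ireg 6 + 2 * w) n := by omega
      refine ⟨by omega, by omega, by omega, by omega,
        ⟨by simpa using h0, by simpa using h1, ?_, s.ireg 6, ?_⟩, by omega⟩
      · simpa [State.key_eq] using ha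
      · simp [e1, e2]
        exact hN

/-- Merges adjacent blocks; the result is written to the arrays `2` and `3`. -/
def mergePassProg : Prog :=
  .iset 2 (.const 0) ;; .iset 3 (.const 0) ;; .iset 4 (.reg 1) ;; .iset 5 (.reg 1) ;;
  .iset 6 (.sub (.reg 0) (.sub (.reg 0) (.add (.reg 1) (.reg 1)))) ;;
  .loop (.ilt (.reg 2) (.reg 0)) mergeStepProg

theorem runs_mergePassProg {W n w : ℕ} {S : Set (ℝ ×ₗ ℝ)} (hw : 0 < w) (hwn : w < n)
    (hW : 10 * n ≤ W) {s : State} (h0 : s.ireg 0 = n) (h1 : s.ireg 1 = w)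
    (ha : BlockSorted (s.key 0 1) n w) (hS : s.key 0 1 '' Set.Iio n = S) :
    Runs W mergePassProg s fun s' t => s'.ireg 0 = n ∧ s'.ireg 1 = w ∧
      BlockSorted (s'.key 2 3) n (2 * w) ∧ s'.key 2 3 '' Set.Iio n = S ∧ t ≤ 300 * n := by
  unfold mergePassProg
  simp
  refine ⟨by omega, by omega, (Runs.loop (MergeState S n w)
    (fun s => 100 * ((n - s.ireg 2) + (n - s.ireg 6))) ?_ ?_).mono ?_⟩
  · intro s hs
    have hs' := hs
    obtain ⟨g0, g1, -, lo, ⟨-, -, g3, g4, g5, g6, g7, g8, -⟩⟩ := hs'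
    refine ⟨by simp; omega, fun hb => ?_⟩
    simp [g0] at hb
    exact runs_mergeStepProg hw hwn hW hs hb
  · have e : s.ireg 0 - (s.ireg 0 - (s.ireg 1 + s.ireg 1)) = min (w + w) n := by omega
    refine ⟨by simpa using h0, by simpa using h1, by simpa [State.key_eq] using ha, 0, ?_⟩
    simp only [e]
    simp [h1]
    exact MergeInv.init hw hwn hS
  · rintro s' t ⟨⟨g0, g1, ha, lo, hM⟩, hb, ht⟩
    simp [g0] at hb ht
    obtain ⟨e1, e2⟩ := hM.final hb
    refine ⟨g0, g1, e1, e2, by omega⟩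

/-- Copies the arrays `2` and `3` to the arrays `0` and `1`. -/
def copyBackProg : Prog :=
  .iset 2 (.const 0) ;;
  .loop (.ilt (.reg 2) (.reg 0))
    (.rput 0 (.reg 2) (.get 2 (.reg 2)) ;; .rput 1 (.reg 2) (.get 3 (.reg 2)) ;;
     .iset 2 (.add (.reg 2) (.const 1)))

theorem runs_copyBackProg {W n w : ℕ} (hW : 10 * n ≤ W) {s : State} (h0 : s.ireg 0 = n)
    (h1 : s.ireg 1 = w) (f : ℕ → ℝ ×ₗ ℝ) (hf : ∀ k < n, s.key 2 3 k = f k) :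
    Runs W copyBackProg s fun s' t => s'.ireg 0 = n ∧ s'.ireg 1 = w ∧
      (∀ k < n, s'.key 0 1 k = f k) ∧ t ≤ 30 * n + 10 := by
  unfold copyBackProg
  simp
  refine (Runs.loop (fun s => s.ireg 0 = n ∧ s.ireg 1 = w ∧ s.ireg 2 ≤ n ∧
    (∀ k < n, s.key 2 3 k = f k) ∧ ∀ k < s.ireg 2, s.key 0 1 k = f k)
    (fun s => 30 * (n - s.ireg 2)) ?_ ?_).mono ?_
  · rintro s ⟨h0, h1, h2, hf, hc⟩
    simp
    refine ⟨by omega, fun hlt => ⟨by omega, by omega, ⟨h0, h1, by omega, ?_, ?_⟩, by omega⟩⟩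
    · simpa [State.key_eq] using hf
    · intro k hk
      by_cases hk' : k = s.ireg 2
      · simpa [State.key_eq, hk'] using hf k (by omega)
      · simpa [State.key_eq, hk'] using hc k (by omega)
  · exact ⟨by simpa using h0, by simpa using h1, by simp, by simpa [State.key_eq] using hf, by simp⟩
  · rintro s' t ⟨⟨h0, h1, h2, -, hc⟩, hb, ht⟩
    simp at hb ht
    exact ⟨h0, h1, fun k hk => hc k (by omega), by omega⟩

/-- Merge sort. -/
def sortProg : Prog :=
  .iset 1 (.const 1) ;;
  .loop (.ilt (.reg 1) (.reg 0))
    (mergePassProg ;; copyBackProg ;; .iset 1 (.add (.reg 1) (.reg 1)))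

/-- Each pass doubles the block length `w` at a cost of at most `400 * n`, so the potential
decreases with `Nat.log 2 w`. The loop ends with `n ≤ w`, when all positions belong to block `0`. -/
theorem runs_sortProg {W n : ℕ} (hn : 2 ≤ n) (hW : 10 * n ≤ W) {s : State} (h0 : s.ireg 0 = n)
    {S : Set (ℝ ×ₗ ℝ)} (hS : s.key 0 1 '' Set.Iio n = S) :
    Runs W sortProg s fun s' t => s'.ireg 0 = n ∧ MonotoneOn (s'.key 0 1) (Set.Iio n) ∧
      s'.key 0 1 '' Set.Iio n = S ∧ t ≤ 400 * n * Nat.clog 2 n + 10 := by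
  unfold sortProg
  simp
  refine ⟨by omega, (Runs.loop (fun s => s.ireg 0 = n ∧ 0 < s.ireg 1 ∧ s.ireg 1 < 2 * n ∧
    BlockSorted (s.key 0 1) n (s.ireg 1) ∧ s.key 0 1 '' Set.Iio n = S)
    (fun s => 400 * n * (Nat.clog 2 n - Nat.log 2 (s.ireg 1))) ?_ ?_).mono ?_⟩
  · rintro s ⟨h0, h1, h2, ha, hS⟩
    refine ⟨by simp; omega, fun hb => ?_⟩
    simp only [Test.eval, IExpr.eval] at hb
    rw [runs_seq]
    refine (runs_mergePassProg h1 (h0 ▸ hb) hW h0 rfl ha hS).mono ?_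
    rintro s₁ t₁ ⟨g0, g1, gs, gS, gt⟩
    rw [runs_seq]
    refine (runs_copyBackProg hW g0 g1 _ fun _ _ => rfl).mono ?_
    rintro s₂ t₂ ⟨k0, k1, kf, kt⟩
    simp [k1]
    refine ⟨by omega, ⟨by simpa using k0, h1, by omega, ?_, ?_⟩, ?_⟩
    · intro x y hxy hy hd
      have := gs x y hxy hy (by rwa [← two_mul] at hd)
      rw [← kf x (by omega), ← kf y hy] at this
      simpa [State.key_eq] using this
    · rw [← gS]
      refine Set.image_congr fun x hx => ?_
      rw [← kf x hx]
      simp [State.key_eq]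
    · have e1 : Nat.log 2 (s.ireg 1 + s.ireg 1) = Nat.log 2 (s.ireg 1) + 1 := by
        rw [← mul_two, Nat.log_mul_base (by norm_num) (by omega)]
      have e2 : Nat.log 2 (s.ireg 1) < Nat.clog 2 n := by
        refine Nat.log_lt_of_lt_pow (by omega) ?_
        have := Nat.le_pow_clog (b := 2) (by norm_num) n
        omega
      rw [e1]
      obtain ⟨d, hd⟩ : ∃ d, Nat.clog 2 n - Nat.log 2 (s.ireg 1) = d + 1 :=
        ⟨Nat.clog 2 n - Nat.log 2 (s.ireg 1) - 1, by omega⟩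
      rw [show Nat.clog 2 n - (Nat.log 2 (s.ireg 1) + 1) = d by omega, hd, mul_add]
      omega
  · refine ⟨by simpa using h0, by simp, by simp; omega, ?_, hS⟩
    intro x y _ _ hd
    simp at hd
    rw [hd]
  · rintro s' t ⟨⟨h0, h1, h2, ha, hS⟩, hb, ht⟩
    simp [h0] at hb ht
    refine ⟨h0, fun x hx y hy hxy => ha x y hxy hy ?_, hS, by omega⟩
    simp only [Set.mem_Iio] at hx hy
    rw [Nat.div_eq_of_lt (by omega), Nat.div_eq_of_lt (by omega)]

end RealRAM

/-! # Recognizing the vertices of a convex hull -/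

/-- Otherwise all extreme points would lie in the open half-plane `⟪u, ·⟫ < ⟪u, x⟫`, and so would
their hull, which by Krein–Milman contains `x`. -/
theorem mem_extremePoints_of_inner_lt {F : Set Plane} (hF : F.Finite) {x u : Plane} (hx : x ∈ F)
    (hu : ∀ y ∈ F, y ≠ x → inner ℝ u y < inner ℝ u x) :
    x ∈ (convexHull ℝ F).extremePoints ℝ := by
  by_contra hcon
  have h1 := closure_convexHull_extremePoints (hF.isCompact_convexHull ℝ) (convex_convexHull ℝ F)
  have h2 : (convexHull ℝ F).extremePoints ℝ ⊆ F := extremePoints_convexHull_subset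
  rw [((hF.subset h2).isClosed_convexHull ℝ).closure_eq] at h1
  have h3 : convexHull ℝ ((convexHull ℝ F).extremePoints ℝ) ⊆ {y | inner ℝ u y < inner ℝ u x} := by
    refine convexHull_min (fun y hy => hu y (h2 hy) ?_)
      (convex_halfSpace_lt (innerSL ℝ u).isLinear _)
    rintro rfl
    exact hcon hy
  rw [h1] at h3
  exact lt_irrefl (inner ℝ u x) (h3 (subset_convexHull ℝ F hx))

theorem isConvexHullCycle_of_inner_lt {h : ℕ} {v : Fin h → Plane} {S : Set Plane}
    (hinj : Function.Injective v) (hv : ∀ i, v i ∈ S) (hS : S ⊆ convexHull ℝ (Set.range v))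
    (hext : ∀ i, ∃ u : Plane, ∀ j ≠ i, inner ℝ u (v j) < inner ℝ u (v i))
    (hpos : ∀ i j k : Fin h, i < j → j < k → 0 < orient (v i) (v j) (v k)) :
    IsConvexHullCycle v S := by
  have hhull : convexHull ℝ S = convexHull ℝ (Set.range v) :=
    (convexHull_min hS (convex_convexHull ℝ _)).antisymm
      (convexHull_mono (Set.range_subset_iff.2 hv))
  refine ⟨hinj, ?_, hpos⟩
  rw [hhull]
  refine Set.Subset.antisymm ?_ extremePoints_convexHull_subset
  rintro _ ⟨i, rfl⟩
  obtain ⟨u, hu⟩ := hext i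
  refine mem_extremePoints_of_inner_lt (u := u) (Set.finite_range v) ⟨i, rfl⟩ ?_
  rintro _ ⟨j, rfl⟩ hj
  exact hu j fun hji => hj (hji ▸ rfl)

/-- If `x` were outside, some functional would be larger at `x` than on the whole polygon. But `x`
is to the left of both edges at a vertex maximizing this functional, so it lies in the angle there.
-/
theorem IsPeriodicPolygon.mem_convexHull {h : ℕ} {w : ℕ → Plane} (hw : IsPeriodicPolygon h w)
    (hh : h ≠ 2) {F : Set Plane} (hF : F.Finite) (hwF : ∀ k, w k ∈ F) (hFw : ∀ y ∈ F, ∃ k, w k = y)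
    {x : Plane} (hx : ∀ k, 0 ≤ orient (w k) (w (k + 1)) x) : x ∈ convexHull ℝ F := by
  have h2 := hw.two_le
  by_contra hcon
  obtain ⟨f, c, hf, hfx⟩ := geometric_hahn_banach_closed_point (convex_convexHull ℝ F)
    (hF.isClosed_convexHull ℝ) hcon
  obtain ⟨u, hu⟩ : ∃ u : Plane, ∀ y, inner ℝ u y = f y :=
    ⟨(InnerProductSpace.toDual ℝ Plane).symm f, fun y => InnerProductSpace.toDual_symm_apply⟩
  obtain ⟨a, ha, b, -, hmax⟩ := exists_inner_le_and_le hF ⟨w 0, hwF 0⟩ u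
  obtain ⟨k, rfl⟩ := hFw a ha
  obtain ⟨j, hj⟩ : ∃ j, k + h = j + 1 := ⟨k + h - 1, by omega⟩
  rw [← hw.periodic k, hj] at hmax
  have hle := inner_le_of_mem_angle (u := u)
    (hw.orient_pos j (j + 1) (j + 2) (by omega) (by omega) (by omega))
    (hx j) (hx (j + 1)) (hmax _ (hwF j)).2 (hmax _ (hwF (j + 2))).2
  have := hf (w (j + 1)) (subset_convexHull ℝ F (hwF _))
  rw [hu, hu] at hle
  linarith

/-- A convex polygon that is spanned by points of `S` and contains `S`. -/
theorem isConvexHullCycle_of_orient {h : ℕ} (h3 : 3 ≤ h) {v : Fin h → Plane} {S : Set Plane}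
    (hinj : Function.Injective v) (hv : ∀ i, v i ∈ S)
    (hpos : ∀ i j k : Fin h, i < j → j < k → 0 < orient (v i) (v j) (v k))
    (hleft : ∀ i j : Fin h, (i + 1 : ℕ) % h = j → ∀ s ∈ S, 0 ≤ orient (v i) (v j) s) :
    IsConvexHullCycle v S := by
  have hw := isPeriodicPolygon_of_orient_pos (by omega) hinj hpos
  set w : ℕ → Plane := fun k => v ⟨k % h, Nat.mod_lt k (by omega)⟩ with hwdef
  have hwv : ∀ i : Fin h, w i = v i := by
    intro i
    simp only [hwdef, Nat.mod_eq_of_lt i.2]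
  refine isConvexHullCycle_of_inner_lt hinj hv (fun s hs => ?_) (fun i => ?_) hpos
  · refine hw.mem_convexHull (by omega) (Set.finite_range v) (fun k => ⟨_, rfl⟩) ?_ fun k => ?_
    · rintro _ ⟨i, rfl⟩
      exact ⟨i, hwv i⟩
    · exact hleft ⟨k % h, _⟩ ⟨(k + 1) % h, _⟩ (by simp) s hs
  · obtain ⟨j, hj⟩ : ∃ j, (i : ℕ) + h = j + 1 := ⟨i + h - 1, by omega⟩
    -- The sum of the outward normals of the two edges at a vertex is maximal at that vertex only.
    refine ⟨-(edgeNormal w j + edgeNormal w (j + 1)), fun i' hi' => ?_⟩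
    obtain ⟨k, hk1, hk2, hk3⟩ := hw.exists_rep (j + 1) i'
    have hij : v i = w (j + 1) := by rw [← hwv, ← hw.periodic, hj]
    have hne : k ≠ j + 1 := by
      rintro rfl
      rw [hwv, ← hij] at hk3
      exact hi' (hinj hk3.symm)
    rw [hij, ← hwv, ← hk3]
    have e1 := inner_edgeNormal_sub w j (w k)
    have e2 := inner_edgeNormal_sub w (j + 1) (w k)
    have e3 := inner_edgeNormal_sub w j (w (j + 1))
    rw [orient_self_right] at e3
    have p1 := hw.orient_edge_nonneg j k
    have p2 := hw.orient_edge_nonneg (j + 1) k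
    have p3 : 0 < orient (w j) (w (j + 1)) (w k) + orient (w (j + 1)) (w (j + 1 + 1)) (w k) := by
      rcases Nat.lt_or_ge (j + 2) k with hlt | hge
      · have := hw.orient_pos (j + 1) (j + 2) k (by omega) hlt hk2
        linarith
      · obtain rfl : k = j + 2 := by omega
        have := hw.orient_pos j (j + 1) (j + 2) (by omega) (by omega) (by omega)
        linarith
    simp only [inner_neg_left, inner_add_left]
    linarith

/-! # The lexicographic order and monotone chains -/

/-- `p` precedes `q` in the lexicographic order. -/
def LexLt (p q : Plane) : Prop := toLex (p 0, p 1) < toLex (q 0, q 1)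

theorem lexLt_iff {p q : Plane} : LexLt p q ↔ p 0 < q 0 ∨ p 0 = q 0 ∧ p 1 < q 1 :=
  Prod.Lex.toLex_lt_toLex

theorem LexLt.trans {p q r : Plane} (h1 : LexLt p q) (h2 : LexLt q r) : LexLt p r :=
  lt_trans (α := ℝ ×ₗ ℝ) h1 h2

theorem LexLt.ne {p q : Plane} (h : LexLt p q) : p ≠ q := by
  rintro rfl
  exact lt_irrefl (α := ℝ ×ₗ ℝ) _ h

theorem LexLt.asymm {p q : Plane} (h1 : LexLt p q) (h2 : LexLt q p) : False :=
  lt_asymm (α := ℝ ×ₗ ℝ) h1 h2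

theorem lexLt_trichotomy (p q : Plane) : LexLt p q ∨ p = q ∨ LexLt q p := by
  rcases lt_trichotomy (toLex (p 0, p 1)) (toLex (q 0, q 1)) with h | h | h
  · exact Or.inl h
  · have := toLex_inj.1 h
    exact Or.inr (Or.inl (Plane.ext_coord (congrArg Prod.fst this) (congrArg Prod.snd this)))
  · exact Or.inr (Or.inr h)

theorem lexLt_neg {p q : Plane} : LexLt (-p) (-q) ↔ LexLt q p := by
  simp only [lexLt_iff, PiLp.neg_apply, neg_lt_neg_iff, neg_inj, eq_comm]

theorem orient_neg (p q r : Plane) : orient (-p) (-q) (-r) = orient p q r := by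
  simp only [orient, PiLp.neg_apply]; ring

/-- Vectors in the open right half-plane, including the upper half of its boundary. -/
def LexPos (x y : ℝ) : Prop := 0 < x ∨ x = 0 ∧ 0 < y

theorem LexLt.lexPos {p q : Plane} (h : LexLt p q) : LexPos (q 0 - p 0) (q 1 - p 1) := by
  rcases lexLt_iff.1 h with h | ⟨h1, h2⟩
  · exact Or.inl (by linarith)
  · exact Or.inr ⟨by linarith, by linarith⟩

/-- The directions of a half-plane are linearly ordered by the angle. -/
theorem LexPos.cross_nonneg {x₁ y₁ x₂ y₂ x₃ y₃ : ℝ} (h1 : LexPos x₁ y₁) (h2 : LexPos x₂ y₂)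
    (h3 : LexPos x₃ y₃) (h12 : 0 ≤ x₁ * y₂ - y₁ * x₂) (h23 : 0 ≤ x₂ * y₃ - y₂ * x₃) :
    0 ≤ x₁ * y₃ - y₁ * x₃ := by
  have id : x₂ * (x₁ * y₃ - y₁ * x₃) =
    x₁ * (x₂ * y₃ - y₂ * x₃) + x₃ * (x₁ * y₂ - y₁ * x₂) := by ring
  have g1 : 0 ≤ x₁ := h1.elim le_of_lt fun h => h.1.ge
  have g3 : 0 ≤ x₃ := h3.elim le_of_lt fun h => h.1.ge
  rcases h2 with h2 | ⟨rfl, h2⟩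
  · refine nonneg_of_mul_nonneg_right ?_ h2
    rw [id]
    positivity
  · have : x₃ = 0 := by nlinarith
    subst this
    rcases h3 with h3 | h3
    · linarith
    · nlinarith [mul_nonneg g1 h3.2.le]

/-- A strict first angle makes the total angle strict. The identity `id` expresses the outer cross
product by the two inner ones; vertical vectors, where it degenerates, are treated apart. -/
theorem LexPos.cross_pos_of_pos_left {x₁ y₁ x₂ y₂ x₃ y₃ : ℝ} (h1 : LexPos x₁ y₁)
    (h2 : LexPos x₂ y₂) (h3 : LexPos x₃ y₃) (h12 : 0 < x₁ * y₂ - y₁ * x₂)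
    (h23 : 0 ≤ x₂ * y₃ - y₂ * x₃) : 0 < x₁ * y₃ - y₁ * x₃ := by
  have id : x₂ * (x₁ * y₃ - y₁ * x₃) =
    x₁ * (x₂ * y₃ - y₂ * x₃) + x₃ * (x₁ * y₂ - y₁ * x₂) := by ring
  have g2 : 0 ≤ x₂ := h2.elim le_of_lt fun h => h.1.ge
  have g1 : 0 < x₁ := by
    rcases h1 with h | ⟨rfl, h⟩
    · exact h
    · nlinarith [mul_nonneg h.le g2]
  rcases h3 with h3 | ⟨rfl, h3⟩
  · rcases h2 with h2 | ⟨rfl, h2⟩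
    · refine pos_of_mul_pos_right ?_ h2.le
      rw [id]
      positivity
    · nlinarith [mul_pos h2 h3]
  · nlinarith [mul_pos g1 h3]

theorem LexPos.cross_pos_of_pos_right {x₁ y₁ x₂ y₂ x₃ y₃ : ℝ} (h1 : LexPos x₁ y₁)
    (h2 : LexPos x₂ y₂) (h3 : LexPos x₃ y₃) (h12 : 0 ≤ x₁ * y₂ - y₁ * x₂)
    (h23 : 0 < x₂ * y₃ - y₂ * x₃) : 0 < x₁ * y₃ - y₁ * x₃ := by
  have id : x₂ * (x₁ * y₃ - y₁ * x₃) =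
    x₁ * (x₂ * y₃ - y₂ * x₃) + x₃ * (x₁ * y₂ - y₁ * x₂) := by ring
  have g3 : 0 ≤ x₃ := h3.elim le_of_lt fun h => h.1.ge
  have g2 : 0 < x₂ := by
    rcases h2 with h | ⟨rfl, h⟩
    · exact h
    · nlinarith [mul_nonneg h.le g3]
  have g1 : 0 < x₁ := by
    rcases h1 with h | ⟨rfl, h⟩
    · exact h
    · nlinarith [mul_pos h g2]
  refine pos_of_mul_pos_right ?_ g2.le
  rw [id]
  positivity

/-- The directions of `b - a`, `c - b`, `d - b` lie in one half-plane and increase in angle. Such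
steps spread left turns of consecutive vertices to all triples of a chain. -/
theorem orient_pos_of_chain_left {a b c d : Plane} (hab : LexLt a b) (hbc : LexLt b c)
    (hcd : LexLt c d) (h1 : 0 < orient a b c) (h2 : 0 < orient b c d) : 0 < orient a b d := by
  have := hab.lexPos.cross_pos_of_pos_left hbc.lexPos (hbc.trans hcd).lexPos
    (by simp only [orient] at h1; linarith) (by simp only [orient] at h2; linarith)
  simp only [orient]
  linarith

theorem orient_pos_of_chain_right {a b c d : Plane} (hab : LexLt a b) (hbc : LexLt b c)
    (hcd : LexLt c d) (h1 : 0 < orient a b c) (h2 : 0 < orient b c d) : 0 < orient a c d := by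
  have := (hab.trans hbc).lexPos.cross_pos_of_pos_left hbc.lexPos hcd.lexPos
    (by simp only [orient] at h1; linarith) (by simp only [orient] at h2; linarith)
  simp only [orient]
  linarith

/-- `l 0, …, l t` is a left-turning chain from `q 0` to `q (k - 1)` below the points
`q 0, …, q (k - 1)`, or it is what remains of such a chain while its last points are being removed
because they lie above the segment from `l t` to `q k`. -/
structure LowerChain (q : ℕ → Plane) (k : ℕ) (l : ℕ → Plane) (t : ℕ) : Prop where
  first : l 0 = q 0
  mem : ∀ a ≤ t, ∃ r < k, l a = q r
  lex : ∀ a b, a < b → b ≤ t → LexLt (l a) (l b)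
  tri : ∀ a b c, a < b → b < c → c ≤ t → 0 < orient (l a) (l b) (l c)
  left : ∀ a r, a < t → r < k → 0 ≤ orient (l a) (l (a + 1)) (q r)

/-- The points `q 0, …, q (k - 1)` after `l t` lie above the segment from `l t` to `q k`. -/
def AboveSegment (q : ℕ → Plane) (k : ℕ) (p : Plane) : Prop :=
  ∀ r < k, LexLt p (q r) → 0 ≤ orient p (q k) (q r)

namespace LowerChain

variable {q l : ℕ → Plane} {n k t : ℕ}

theorem aboveSegment_of_eq (hq : ∀ a b, a < b → b < n → LexLt (q a) (q b)) (hk : k ≤ n) {p : Plane}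
    (hp : p = q (k - 1)) : AboveSegment q k p := by
  intro r hr hlt
  exfalso
  rw [hp] at hlt
  rcases Nat.lt_or_ge r (k - 1) with h | h
  · exact hlt.asymm (hq r (k - 1) h (by omega))
  · obtain rfl : r = k - 1 := by omega
    exact hlt.ne rfl

theorem lexLt_next (hq : ∀ a b, a < b → b < n → LexLt (q a) (q b)) (hk : k < n)
    (hl : LowerChain q k l t) {a : ℕ} (ha : a ≤ t) : LexLt (l a) (q k) := by
  obtain ⟨r, hr, e⟩ := hl.mem a ha
  rw [e]
  exact hq r k hr hk

/-- Seen from `l t`, the direction to `q k` is not above the one to the removed vertex, which in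
turn is not above the directions to the later points. -/
theorem pop (hq : ∀ a b, a < b → b < n → LexLt (q a) (q b)) (hk : k < n)
    (hl : LowerChain q k l (t + 1)) (hturn : orient (l t) (l (t + 1)) (q k) ≤ 0) :
    LowerChain q k l t ∧ AboveSegment q k (l t) := by
  refine ⟨⟨hl.first, fun a ha => hl.mem a (by omega), fun a b hab hb => hl.lex a b hab (by omega),
    fun a b c hab hbc hc => hl.tri a b c hab hbc (by omega),
    fun a r ha => hl.left a r (by omega)⟩, fun r hr hlt => ?_⟩
  have h1 := hl.left t r (by omega) hr
  have := (lexLt_next hq hk hl (a := t) (by omega)).lexPos.cross_nonneg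
    (hl.lex t (t + 1) (by omega) le_rfl).lexPos hlt.lexPos
    (by simp only [orient] at hturn; linarith) (by simp only [orient] at h1; linarith)
  simp only [orient]
  linarith

theorem push (hq : ∀ a b, a < b → b < n → LexLt (q a) (q b)) (hk : k < n)
    (hl : LowerChain q k l t) (habove : AboveSegment q k (l t))
    (hturn : ∀ a, a + 1 = t → 0 < orient (l a) (l t) (q k)) :
    LowerChain q (k + 1) (Function.update l (t + 1) (q k)) (t + 1) := by
  have hold : ∀ a, a ≤ t → Function.update l (t + 1) (q k) a = l a := fun a ha =>
    Function.update_of_ne (by omega) _ _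
  have hnew : Function.update l (t + 1) (q k) (t + 1) = q k := Function.update_self _ _ _
  have hnext : ∀ a ≤ t, LexLt (l a) (q k) := fun a ha => hl.lexLt_next hq hk ha
  have htop : ∀ a < t, 0 < orient (l a) (l t) (q k) := by
    intro a ha
    obtain ⟨b, rfl⟩ : ∃ b, t = b + 1 := ⟨t - 1, by omega⟩
    rcases Nat.lt_or_ge a b with hab | hab
    · exact orient_pos_of_chain_right (hl.lex a b hab (by omega))
        (hl.lex b (b + 1) (by omega) le_rfl) (hnext _ le_rfl) (hl.tri a b _ hab (by omega) le_rfl)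
        (hturn b rfl)
    · obtain rfl : a = b := by omega
      exact hturn a rfl
  have htri : ∀ a b, a < b → b ≤ t → 0 < orient (l a) (l b) (q k) := by
    intro a b hab hb
    rcases hb.eq_or_lt with rfl | hb
    · exact htop a hab
    · exact orient_pos_of_chain_left (hl.lex a b hab hb.le) (hl.lex b t hb le_rfl) (hnext t le_rfl)
        (hl.tri a b t hab hb le_rfl) (htop b hb)
  refine ⟨by rw [hold 0 (by omega)]; exact hl.first, fun a ha => ?_, fun a b hab hb => ?_,
    fun a b c hab hbc hc => ?_, fun a r ha hr => ?_⟩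
  · rcases Nat.le_succ_iff.1 ha with h | rfl
    · obtain ⟨r, hr, e⟩ := hl.mem a h
      exact ⟨r, by omega, by rw [hold a h, e]⟩
    · exact ⟨k, by omega, hnew⟩
  · rw [hold a (by omega)]
    rcases Nat.le_succ_iff.1 hb with h | rfl
    · rw [hold b h]
      exact hl.lex a b hab h
    · rw [hnew]
      exact hnext a (by omega)
  · rw [hold a (by omega), hold b (by omega)]
    rcases Nat.le_succ_iff.1 hc with h | rfl
    · rw [hold c h]
      exact hl.tri a b c hab hbc h
    · rw [hnew]
      exact htri a b hab (by omega)
  · rw [hold a (by omega)]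
    rcases Nat.lt_succ_iff_lt_or_eq.1 ha with ha | rfl
    · rw [hold (a + 1) (by omega)]
      rcases Nat.lt_succ_iff_lt_or_eq.1 hr with hr | rfl
      · exact hl.left a r ha hr
      · exact (htri a (a + 1) (by omega) (by omega)).le
    · rw [hnew]
      rcases Nat.lt_succ_iff_lt_or_eq.1 hr with hr | rfl
      -- Here `a` is the old top. Later points are covered by `habove`. An earlier point is
      -- impossible for `a = 0`; otherwise it is to the left of the preceding edge, from which the
      -- new edge turns left.
      · rcases lexLt_trichotomy (l a) (q r) with h | h | h
        · exact habove r hr h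
        · rw [← h, orient_self_left]
        · rcases Nat.eq_zero_or_pos a with rfl | hpos
          · rw [hl.first] at h
            rcases Nat.eq_zero_or_pos r with rfl | hr0
            · exact absurd rfl h.ne
            · exact (h.asymm (hq 0 r hr0 (by omega))).elim
          · obtain ⟨b, rfl⟩ : ∃ b, a = b + 1 := ⟨a - 1, by omega⟩
            have h1 := hl.left b r (by omega) hr
            have h2 := hturn b rfl
            have := h.lexPos.cross_pos_of_pos_right
              (hl.lex b (b + 1) (by omega) le_rfl).lexPos (hnext _ le_rfl).lexPos
              (by simp only [orient] at h1; linarith) (by simp only [orient] at h2; linarith)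
            simp only [orient]
            linarith
      · rw [orient_self_right]

theorem single (q : ℕ → Plane) (hl : l 0 = q 0) : LowerChain q 1 l 0 :=
  ⟨hl, fun a ha => ⟨0, by omega, by rw [Nat.le_zero.1 ha, hl]⟩, fun a b hab hb => by omega,
    fun a b c hab hbc hc => by omega, fun a r ha => by omega⟩

/-- A point above the segment that joins the ends of a chain is to the left of all its chords. -/
theorem orient_pos_of_above (hl : LowerChain q k l t) {x : Plane} (h0 : LexLt (l 0) x)
    (ht : LexLt x (l t)) (hx : 0 < orient (l 0) (l t) x) {a b : ℕ} (hab : a < b) (hb : b ≤ t) :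
    0 < orient (l a) (l b) x := by
  have hlt := h0.trans ht
  have left : ∀ b, 0 < b → b ≤ t → 0 < orient (l 0) (l b) x := by
    intro b hb0 hb
    rcases hb.eq_or_lt with rfl | hb
    · exact hx
    · have h1 := hl.tri 0 b t hb0 hb le_rfl
      have := (hl.lex 0 b hb0 hb.le).lexPos.cross_pos_of_pos_left hlt.lexPos h0.lexPos
        (by simp only [orient] at h1; linarith) (by simp only [orient] at hx; linarith)
      simp only [orient]
      linarith
  rcases Nat.eq_zero_or_pos a with rfl | ha
  · exact left b hab hb
  have right : 0 < orient (l a) (l t) x := by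
    have h1 := hl.tri 0 a t ha (by omega) le_rfl
    have := ht.lexPos.cross_pos_of_pos_left hlt.lexPos (hl.lex a t (by omega) le_rfl).lexPos
      (by simp only [orient] at hx; linarith) (by simp only [orient] at h1; linarith)
    simp only [orient]
    linarith
  rcases hb.eq_or_lt with rfl | hb
  · exact right
  -- If `x` comes after `l a`, the chord is compared with the one from `l a` to `l t`; if before,
  -- with the one from `l 0` to `l b`.
  rcases lexLt_trichotomy (l a) x with h | h | h
  · have h1 := hl.tri a b t hab hb le_rfl
    have := (hl.lex a b hab hb.le).lexPos.cross_pos_of_pos_left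
      (hl.lex a t (by omega) le_rfl).lexPos h.lexPos
      (by simp only [orient] at h1; linarith) (by simp only [orient] at right; linarith)
    simp only [orient]
    linarith
  · rw [← h, orient_self_left] at right
    exact absurd right (lt_irrefl _)
  · have h1 := left b (by omega) hb.le
    have h2 := hl.tri 0 a b ha hab hb.le
    have := (h.trans (hl.lex a b hab hb.le)).lexPos.cross_pos_of_pos_left
      (hl.lex 0 b (by omega) hb.le).lexPos (hl.lex a b hab hb.le).lexPos
      (by simp only [orient] at h1; linarith) (by simp only [orient] at h2; linarith)
    simp only [orient]
    linarith

end LowerChain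

/-! # Joining the lower and the upper chain -/

theorem orient_self_self (p r : Plane) : orient p p r = 0 := by
  simp only [orient]; ring

/-- As `h ≥ 3`, any two indices extend to an increasing triple, and a triangle with a repeated
vertex has area `0`. -/
theorem injective_of_orient_pos {h : ℕ} (h3 : 3 ≤ h) {v : Fin h → Plane}
    (hpos : ∀ i j k : Fin h, i < j → j < k → 0 < orient (v i) (v j) (v k)) :
    Function.Injective v := by
  have key : ∀ i j : Fin h, i < j → v i ≠ v j := by
    intro i j hij heq
    rcases Nat.lt_or_ge (j + 1) h with hj | hj
    · have := hpos i j ⟨j + 1, hj⟩ hij (Fin.lt_def.2 (by simp))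
      rw [heq, orient_self_self] at this
      exact lt_irrefl _ this
    rcases Nat.eq_zero_or_pos (i : ℕ) with hi | hi
    · have := hpos i ⟨1, by omega⟩ j (Fin.lt_def.2 (by simp [hi])) (Fin.lt_def.2 (by simp; omega))
      rw [heq, orient_self_left] at this
      exact lt_irrefl _ this
    · have := hpos ⟨0, by omega⟩ i j (Fin.lt_def.2 (by simpa using hi)) hij
      rw [heq, orient_self_right] at this
      exact lt_irrefl _ this
  intro i j heq
  rcases lt_trichotomy i j with h | h | h
  · exact absurd heq (key i j h)
  · exact h
  · exact absurd heq.symm (key j i h)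

theorem LexPos.dot_nonneg {x₁ y₁ x₂ y₂ : ℝ} (h1 : LexPos x₁ y₁) (h2 : LexPos x₂ y₂)
    (h : x₁ * y₂ = y₁ * x₂) : 0 ≤ x₁ * x₂ + y₁ * y₂ := by
  have g2 : 0 ≤ x₂ := h2.elim le_of_lt fun h => h.1.ge
  rcases h1 with h1 | ⟨rfl, h1⟩
  · refine nonneg_of_mul_nonneg_right ?_ h1
    have : x₁ * (x₁ * x₂ + y₁ * y₂) = (x₁ ^ 2 + y₁ ^ 2) * x₂ := by linear_combination y₁ * h
    rw [this]
    positivity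
  · have : x₂ = 0 := by nlinarith
    subst this
    rcases h2 with h2 | ⟨-, h2⟩
    · linarith
    · simp only [zero_mul, zero_add]
      positivity

theorem mem_segment_of_lexLt {p q x : Plane} (hpx : LexLt p x) (hxq : LexLt x q)
    (h : orient p q x = 0) : x ∈ segment ℝ p q := by
  have hD := (hpx.trans hxq).lexPos
  simp only [orient] at h
  have n1 := hD.dot_nonneg hpx.lexPos (by linarith)
  have n2 := hD.dot_nonneg hxq.lexPos (by linarith)
  set d₀ := q 0 - p 0 with hd₀
  set d₁ := q 1 - p 1 with hd₁
  have hpos : 0 < d₀ * d₀ + d₁ * d₁ := by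
    rcases hD with h | ⟨h1, h⟩
    · nlinarith [mul_self_nonneg d₁, mul_pos h h]
    · rw [h1]
      nlinarith [mul_pos h h]
  rw [segment_eq_image']
  -- The parameter is the coefficient of the orthogonal projection of `x - p` onto `q - p`; the two
  -- dot products put it in `[0, 1]`.
  refine ⟨(d₀ * (x 0 - p 0) + d₁ * (x 1 - p 1)) / (d₀ * d₀ + d₁ * d₁),
    ⟨div_nonneg n1 hpos.le, (div_le_one hpos).2 ?_⟩, ?_⟩
  · have e0 : q 0 - x 0 = d₀ - (x 0 - p 0) := by rw [hd₀]; ring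
    have e1 : q 1 - x 1 = d₁ - (x 1 - p 1) := by rw [hd₁]; ring
    rw [e0, e1] at n2
    linarith
  · refine Plane.ext_coord ?_ ?_
    · simp only [PiLp.add_apply, PiLp.smul_apply, PiLp.sub_apply, smul_eq_mul, ← hd₀]
      rw [div_mul_eq_mul_div, ← eq_sub_iff_add_eq', div_eq_iff hpos.ne']
      linear_combination d₁ * h
    · simp only [PiLp.add_apply, PiLp.smul_apply, PiLp.sub_apply, smul_eq_mul, ← hd₁]
      rw [div_mul_eq_mul_div, ← eq_sub_iff_add_eq', div_eq_iff hpos.ne']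
      linear_combination (-d₀) * h

/-- The two chains of a convex polygon, put together: the upper chain is given as the lower chain
of the reflected points. -/
def joinChains (l l' : ℕ → Plane) (t : ℕ) (i : ℕ) : Plane := if i < t then l i else -l' (i - t)

section Join

variable {q l l' : ℕ → Plane} {n t t' : ℕ}

theorem lexLt_reflect (hq : ∀ a b, a < b → b < n → LexLt (q a) (q b)) (a b : ℕ) (hab : a < b)
    (hb : b < n) : LexLt (-q (n - 1 - a)) (-q (n - 1 - b)) :=
  lexLt_neg.2 (hq _ _ (by omega) (by omega))

theorem joinChains_of_le (h : -l' 0 = l t) {i : ℕ} (hi : i ≤ t) : joinChains l l' t i = l i := by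
  unfold joinChains
  split_ifs with h1
  · rfl
  · obtain rfl : i = t := by omega
    rw [Nat.sub_self, h]

theorem joinChains_of_ge {i : ℕ} (hi : t ≤ i) : joinChains l l' t i = -l' (i - t) :=
  if_neg (by omega)

/-- Three vertices of one chain turn left by `tri`. When they are split between the chains, the
single vertex is above the segment joining the ends of the other chain, up to reflection, and
`orient_pos_of_above` applies, or it is such an end itself. -/
theorem orient_joinChains_pos
    (hl : LowerChain q n l t) (hl' : LowerChain (fun k => -q (n - 1 - k)) n l' t')
    (h0 : -l' 0 = l t) (h1 : -l' t' = l 0) {i j k : ℕ} (hij : i < j) (hjk : j < k)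
    (hk : k < t + t') :
    0 < orient (joinChains l l' t i) (joinChains l l' t j) (joinChains l l' t k) := by
  have g0 : l' 0 = -l t := by rw [← h0, neg_neg]
  have g1 : l' t' = -l 0 := by rw [← h1, neg_neg]
  rcases Nat.lt_or_ge t k with hk1 | hk1
  · rw [joinChains_of_ge hk1.le]
    rcases Nat.lt_or_ge i t with hi | hi
    · rw [joinChains_of_le h0 hi.le]
      rcases Nat.lt_or_ge t j with hj | hj
      · rw [joinChains_of_ge hj.le, orient_rotate, ← neg_neg (l i), orient_neg]
        rcases Nat.eq_zero_or_pos i with rfl | hi0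
        · rw [← g1]
          exact hl'.tri _ _ _ (by omega) (by omega) le_rfl
        · refine hl'.orient_pos_of_above ?_ ?_ ?_ (by omega) (by omega)
          · rw [g0]
            exact lexLt_neg.2 (hl.lex i t hi le_rfl)
          · rw [g1]
            exact lexLt_neg.2 (hl.lex 0 i hi0 hi.le)
          · rw [g0, g1, orient_neg, orient_rotate]
            exact hl.tri 0 i t hi0 hi le_rfl
      · rw [joinChains_of_le h0 hj]
        refine hl.orient_pos_of_above ?_ ?_ ?_ hij hj
        · rw [← h1]
          exact lexLt_neg.2 (hl'.lex _ _ (by omega) le_rfl)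
        · rw [← h0]
          exact lexLt_neg.2 (hl'.lex _ _ (by omega) (by omega))
        · rw [← h0, ← h1, orient_neg, orient_rotate]
          exact hl'.tri _ _ _ (by omega) (by omega) le_rfl
    · rw [joinChains_of_ge hi, joinChains_of_ge (by omega), orient_neg]
      exact hl'.tri _ _ _ (by omega) (by omega) (by omega)
  · rw [joinChains_of_le h0 (by omega), joinChains_of_le h0 (by omega), joinChains_of_le h0 hk1]
    exact hl.tri i j k hij hjk hk1

theorem orient_joinChains_nonneg (hl : LowerChain q n l t)
    (hl' : LowerChain (fun k => -q (n - 1 - k)) n l' t') (h0 : -l' 0 = l t) {i r : ℕ}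
    (hi : i < t + t') (hr : r < n) :
    0 ≤ orient (joinChains l l' t i) (joinChains l l' t (i + 1)) (q r) := by
  rcases Nat.lt_or_ge i t with hit | hit
  · rw [joinChains_of_le h0 hit.le, joinChains_of_le h0 hit]
    exact hl.left i r hit hr
  · rw [joinChains_of_ge hit, joinChains_of_ge (by omega), ← neg_neg (q r), orient_neg]
    have := hl'.left (i - t) (n - 1 - r) (by omega) (by omega)
    simpa only [show i + 1 - t = i - t + 1 by omega, show n - 1 - (n - 1 - r) = r by omega] using this

theorem isConvexHullCycle_joinChains (hn : 2 ≤ n) (hq : ∀ a b, a < b → b < n → LexLt (q a) (q b))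
    (hl : LowerChain q n l t) (hlast : l t = q (n - 1))
    (hl' : LowerChain (fun k => -q (n - 1 - k)) n l' t') (hlast' : l' t' = -q (n - 1 - (n - 1))) :
    IsConvexHullCycle (fun i : Fin (t + t') => joinChains l l' t i) (q '' Set.Iio n) := by
  have h0 : -l' 0 = l t := by rw [hl'.first, hlast]; simp
  have h1 : -l' t' = l 0 := by rw [hlast', hl.first]; simp
  have ht : 0 < t := by
    rcases Nat.eq_zero_or_pos t with rfl | h
    · exact absurd (hl.first.symm.trans hlast) (hq 0 (n - 1) (by omega) (by omega)).ne
    · exact h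
  have ht' : 0 < t' := by
    rcases Nat.eq_zero_or_pos t' with rfl | h
    · exact absurd (h1.symm.trans h0) (hl.lex 0 t ht le_rfl).ne
    · exact h
  have hmem : ∀ i : Fin (t + t'), joinChains l l' t i ∈ q '' Set.Iio n := by
    intro i
    rcases Nat.lt_or_ge i t with hi | hi
    · rw [joinChains_of_le h0 hi.le]
      obtain ⟨r, hr, e⟩ := hl.mem i hi.le
      exact ⟨r, hr, e.symm⟩
    · rw [joinChains_of_ge hi]
      obtain ⟨r, hr, e⟩ := hl'.mem (i - t) (by omega)
      exact ⟨n - 1 - r, by simp only [Set.mem_Iio]; omega, by rw [e, neg_neg]⟩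
  have hpos : ∀ i j k : Fin (t + t'), i < j → j < k →
      0 < orient (joinChains l l' t i) (joinChains l l' t j) (joinChains l l' t k) :=
    fun i j k hij hjk => orient_joinChains_pos hl hl' h0 h1 hij hjk k.2
  have hwrap : joinChains l l' t (t + t') = joinChains l l' t 0 := by
    rw [joinChains_of_ge (by omega), joinChains_of_le h0 (by omega), Nat.add_sub_cancel_left, h1]
  rcases Nat.lt_or_ge 2 (t + t') with h3 | h3
  · refine isConvexHullCycle_of_orient h3 (injective_of_orient_pos h3 hpos) hmem hpos ?_
    rintro i j hij _ ⟨r, hr, rfl⟩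
    have e : joinChains l l' t j = joinChains l l' t (i + 1) := by
      rcases Nat.lt_or_ge (i + 1) (t + t') with hi | hi
      · rw [← hij, Nat.mod_eq_of_lt hi]
      · have hi' : (i + 1 : ℕ) = t + t' := by omega
        rw [hi', Nat.mod_self] at hij
        rw [hi', ← hij, hwrap]
    simp only [e]
    exact orient_joinChains_nonneg hl hl' h0 i.2 hr
  · obtain rfl : t = 1 := by omega
    obtain rfl : t' = 1 := by omega
    have v0 : joinChains l l' 1 0 = q 0 := by rw [joinChains_of_le h0 (by omega), hl.first]
    have v1 : joinChains l l' 1 1 = q (n - 1) := by rw [joinChains_of_le h0 le_rfl, hlast]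
    have hlt := hq 0 (n - 1) (by omega) (by omega)
    have hpq : ∀ {x y : Plane}, x ≠ y → inner ℝ (x - y) y < inner ℝ (x - y) x := by
      intro x y hxy
      rw [← sub_pos, ← inner_sub_right]
      exact real_inner_self_pos.2 (sub_ne_zero.2 hxy)
    refine isConvexHullCycle_of_inner_lt ?_ hmem ?_ ?_ hpos
    · intro i j hij
      fin_cases i <;> fin_cases j
      · rfl
      · exact absurd (v0.symm.trans (hij.trans v1)) hlt.ne
      · exact absurd (v0.symm.trans (hij.symm.trans v1)) hlt.ne
      · rfl
    · rintro _ ⟨r, hr, rfl⟩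
      have m0 : q 0 ∈ convexHull ℝ (Set.range fun i : Fin (1 + 1) => joinChains l l' 1 i) :=
        subset_convexHull ℝ _ ⟨0, v0⟩
      have m1 : q (n - 1) ∈ convexHull ℝ (Set.range fun i : Fin (1 + 1) => joinChains l l' 1 i) :=
        subset_convexHull ℝ _ ⟨1, v1⟩
      have hr : r < n := hr
      rcases Nat.eq_zero_or_pos r with rfl | hr0
      · exact m0
      rcases Nat.lt_or_ge r (n - 1) with hr1 | hr1
      · refine (convex_convexHull ℝ _).segment_subset m0 m1
          (mem_segment_of_lexLt (hq 0 r hr0 hr) (hq r (n - 1) hr1 (by omega)) ?_)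
        -- Both chains are the single segment from `q 0` to `q (n - 1)`. The point is weakly left of
        -- it in both directions, hence on its line.
        have a1 := orient_joinChains_nonneg hl hl' h0 (i := 0) (by omega) hr
        have a2 := orient_joinChains_nonneg hl hl' h0 (i := 1) (by omega) hr
        have hwrap : joinChains l l' 1 (1 + 1) = joinChains l l' 1 0 := hwrap
        rw [v0, zero_add, v1] at a1
        rw [hwrap, v0, v1] at a2
        simp only [orient] at a1 a2 ⊢
        linarith
      · obtain rfl : r = n - 1 := by omega
        exact m1
    · intro i
      fin_cases i
      · refine ⟨q 0 - q (n - 1), fun j hj => ?_⟩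
        fin_cases j
        · exact absurd rfl hj
        · simp only [v0, v1]
          exact hpq hlt.ne
      · refine ⟨q (n - 1) - q 0, fun j hj => ?_⟩
        fin_cases j
        · simp only [v0, v1]
          exact hpq hlt.ne.symm
        · exact absurd rfl hj

end Join

/-! # Computing the convex hull -/

namespace RealRAM

/-- The arrays `A` and `B` hold the coordinates of the first `n` terms of `q`. -/
def State.HoldsAt (s : State) (A B n : ℕ) (q : ℕ → Plane) : Prop :=
  ∀ k < n, s.rarr A k = q k 0 ∧ s.rarr B k = q k 1

/-- Twice the signed area of the triangle of the top two points of the stack in the arrays `C` and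
`D` and the next point in the arrays `A` and `B`. -/
def topOrient (A B C D : ℕ) : RExpr :=
  .sub
    (.mul (.sub (.get C (.reg 3)) (.get C (.sub (.reg 3) (.const 1))))
      (.sub (.get B (.reg 2)) (.get D (.sub (.reg 3) (.const 1)))))
    (.mul (.sub (.get D (.reg 3)) (.get D (.sub (.reg 3) (.const 1))))
      (.sub (.get A (.reg 2)) (.get C (.sub (.reg 3) (.const 1)))))

/-- One step of the scan: the top of the stack is removed, or the next point is put on it. -/
def scanStepProg (A B C D : ℕ) : Prog :=
  .ite (.and (.ilt (.const 0) (.reg 3)) (.not (.rlt (.const 0) (topOrient A B C D))))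
    (.iset 3 (.sub (.reg 3) (.const 1)))
    (.iset 3 (.add (.reg 3) (.const 1)) ;;
     .rput C (.reg 3) (.get A (.reg 2)) ;; .rput D (.reg 3) (.get B (.reg 2)) ;;
     .iset 2 (.add (.reg 2) (.const 1)))

/-- Computes the lower chain of the sorted points in the arrays `A` and `B`. -/
def scanProg (A B C D : ℕ) : Prog :=
  .rput C (.const 0) (.get A (.const 0)) ;; .rput D (.const 0) (.get B (.const 0)) ;;
  .iset 2 (.const 1) ;; .iset 3 (.const 0) ;;
  .loop (.ilt (.reg 2) (.reg 0)) (scanStepProg A B C D)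

/-- The states `s` and `s'` differ at most in the registers `2`, `3` and the arrays `C`, `D`. -/
def FrameEq (C D : ℕ) (s s' : State) : Prop :=
  (∀ x, x ≠ 2 → x ≠ 3 → s'.ireg x = s.ireg x) ∧ ∀ E, E ≠ C → E ≠ D → s'.rarr E = s.rarr E

/-- Invariant of the scan. -/
structure ScanInv (C D n : ℕ) (q : ℕ → Plane) (s₀ s : State) : Prop where
  frame : FrameEq C D s₀ s
  one_le : 1 ≤ s.ireg 2
  le : s.ireg 2 ≤ n
  top_lt : s.ireg 3 < s.ireg 2
  chain : ∃ l, LowerChain q (s.ireg 2) l (s.ireg 3) ∧ s.HoldsAt C D (s.ireg 3 + 1) l ∧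
    (l (s.ireg 3) = q (s.ireg 2 - 1) ∨
      s.ireg 2 < n ∧ AboveSegment q (s.ireg 2) (l (s.ireg 3)))

variable {W n A B C D : ℕ} {q : ℕ → Plane}

/-- The potential `2 * (n - k) + t`, up to the factor `100`, drops by `1` both when a point is
pushed (`k` and `t` grow) and when one is popped. -/
theorem runs_scanStepProg (hAC : A ≠ C) (hAD : A ≠ D) (hBC : B ≠ C) (hBD : B ≠ D) (hCD : C ≠ D)
    (hq : ∀ a b, a < b → b < n → LexLt (q a) (q b)) (hW : 10 * n ≤ W) {s₀ s : State}
    (hA : s₀.HoldsAt A B n q) (hs : ScanInv C D n q s₀ s) (hk : s.ireg 2 < n) :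
    Runs W (scanStepProg A B C D) s fun s' t => ScanInv C D n q s₀ s' ∧
      3 + t + 100 * (2 * (n - s'.ireg 2) + s'.ireg 3) ≤
        100 * (2 * (n - s.ireg 2) + s.ireg 3) := by
  obtain ⟨hf, h1, h2, h3, l, hl, hst, htop⟩ := hs
  have habove : AboveSegment q (s.ireg 2) (l (s.ireg 3)) :=
    htop.elim (LowerChain.aboveSegment_of_eq hq h2) And.right
  have hqk : s.rarr A (s.ireg 2) = q (s.ireg 2) 0 ∧ s.rarr B (s.ireg 2) = q (s.ireg 2) 1 := by
    rw [hf.2 A hAC hAD, hf.2 B hBC hBD]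
    exact hA _ hk
  obtain ⟨k, hkk⟩ : ∃ k, s.ireg 2 = k := ⟨_, rfl⟩
  obtain ⟨m, hm⟩ : ∃ m, s.ireg 3 = m := ⟨_, rfl⟩
  rw [hkk] at h1 h2 h3 hl habove hqk hk
  rw [hm] at h3 hl hst habove
  have ht1 := hst m (by omega)
  have ht0 := hst (m - 1) (by omega)
  have horient : (topOrient A B C D).eval s = orient (l (m - 1)) (l m) (q k) := by
    simp [topOrient, orient, hkk, hm, ht0, ht1, hqk]
  unfold scanStepProg
  rw [runs_ite]
  refine ⟨by simp [hkk, hm, topOrient]; omega, fun hb => ?_, fun hb => ?_⟩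
  · simp only [Test.eval, horient, IExpr.eval, RExpr.eval, hm, Int.cast_zero, not_lt] at hb
    simp [hkk, hm, topOrient]
    obtain ⟨j, rfl⟩ : ∃ j, m = j + 1 := ⟨m - 1, by omega⟩
    obtain ⟨hl', ha'⟩ := hl.pop hq hk hb.2
    refine ⟨by omega, ⟨⟨fun x hx2 hx3 => ?_, fun E hE hE' => hf.2 E hE hE'⟩, ?_, ?_, ?_, l, ?_, ?_, ?_⟩,
      by omega⟩
    · simpa [hx3] using hf.1 x hx2 hx3
    · simp; omega
    · simp; omega
    · simp; omega
    · simpa [hkk] using hl'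
    · intro a ha
      simp at ha
      exact hst a (by omega)
    · simpa [hkk] using Or.inr ⟨hk, ha'⟩
  · simp only [Test.eval, horient, IExpr.eval, RExpr.eval, hm, Int.cast_zero, not_and,
      not_not] at hb
    simp [hkk, hm, topOrient, hBC, hCD.symm, hqk]
    have hl' := hl.push hq hk habove fun a ha => by
      subst ha
      simpa using hb (by omega)
    refine ⟨by omega, by omega, by omega,
      ⟨⟨fun x hx2 hx3 => ?_, fun E hE hE' => ?_⟩, ?_, ?_, ?_, Function.update l (m + 1) (q k),
        ?_, ?_, ?_⟩,
      by omega⟩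
    · simpa [hx3, hx2] using hf.1 x hx2 hx3
    · simpa [hE, hE'] using hf.2 E hE hE'
    · simp
    · simp; omega
    · simp; omega
    · simpa using hl'
    · intro a ha
      simp at ha
      by_cases ha' : a = m + 1
      · subst ha'
        simp [hCD]
      · simpa [hCD, ha'] using hst a (by omega)
    · simp

theorem runs_scanProg (hAC : A ≠ C) (hAD : A ≠ D) (hBC : B ≠ C) (hBD : B ≠ D) (hCD : C ≠ D)
    (hn : 1 ≤ n) (hq : ∀ a b, a < b → b < n → LexLt (q a) (q b)) (hW : 10 * n ≤ W) {s₀ : State}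
    (h0 : s₀.ireg 0 = n) (hA : s₀.HoldsAt A B n q) :
    Runs W (scanProg A B C D) s₀ fun s t => FrameEq C D s₀ s ∧ s.ireg 3 < n ∧ t ≤ 300 * n ∧
      ∃ l, LowerChain q n l (s.ireg 3) ∧ s.HoldsAt C D (s.ireg 3 + 1) l ∧
        l (s.ireg 3) = q (n - 1) := by
  unfold scanProg
  simp [hBC]
  refine ⟨by omega, (Runs.loop (ScanInv C D n q s₀)
    (fun s => 100 * (2 * (n - s.ireg 2) + s.ireg 3)) ?_ ?_).mono ?_⟩
  · intro s hs
    have e := hs.frame.1 0 (by norm_num) (by norm_num)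
    have e1 := hs.le
    refine ⟨by simp; omega, fun hb => ?_⟩
    simp [e, h0] at hb
    exact runs_scanStepProg hAC hAD hBC hBD hCD hq hW hA hs hb
  · refine ⟨⟨fun x hx2 hx3 => ?_, fun E hE hE' => ?_⟩, ?_, ?_, ?_, q, ?_, ?_, ?_⟩
    · simp [hx2, hx3]
    · simp [hE, hE']
    · simp
    · simpa using hn
    · simp
    · simpa using LowerChain.single q rfl
    · intro a ha
      obtain rfl : a = 0 := by simpa using ha
      simpa [hCD, hCD.symm] using hA 0 hn
    · simp
  · rintro s t ⟨⟨hf, h1, h2, h3, l, hl, hst, htop⟩, hb, ht⟩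
    have e := hf.1 0 (by norm_num) (by norm_num)
    simp [e, h0] at hb ht
    have e2 : s.ireg 2 = n := by omega
    rw [e2] at hl htop
    exact ⟨hf, by omega, by omega, l, hl, hst, htop.resolve_right fun h => lt_irrefl _ h.1⟩

/-- Copies the sorted points to the arrays `2`, `3`, and their reflections, in reverse order, to the
arrays `4`, `5`. -/
def splitProg : Prog :=
  .iset 2 (.const 0) ;;
  .loop (.ilt (.reg 2) (.reg 0))
    (.rput 2 (.reg 2) (.get 0 (.reg 2)) ;; .rput 3 (.reg 2) (.get 1 (.reg 2)) ;;
     .iset 3 (.sub (.sub (.reg 0) (.const 1)) (.reg 2)) ;;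
     .rput 4 (.reg 2) (.sub (.const 0) (.get 0 (.reg 3))) ;;
     .rput 5 (.reg 2) (.sub (.const 0) (.get 1 (.reg 3))) ;;
     .iset 2 (.add (.reg 2) (.const 1)))

theorem State.holdsAt_update {s s' : State} {k : ℕ} (hs : s.HoldsAt A B k q)
    (hA : s'.rarr A = Function.update (s.rarr A) k (q k 0))
    (hB : s'.rarr B = Function.update (s.rarr B) k (q k 1)) : s'.HoldsAt A B (k + 1) q := by
  intro a ha
  rw [hA, hB]
  rcases Nat.lt_succ_iff_lt_or_eq.1 ha with ha | rfl
  · rw [Function.update_of_ne ha.ne, Function.update_of_ne ha.ne]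
    exact hs a ha
  · rw [Function.update_self, Function.update_self]
    exact ⟨rfl, rfl⟩

theorem runs_splitProg (hW : 10 * n ≤ W) {s : State} (hn : 1 ≤ n) (h0 : s.ireg 0 = n)
    (hA : s.HoldsAt 0 1 n q) :
    Runs W splitProg s fun s' t => s'.ireg 0 = n ∧ s'.HoldsAt 2 3 n q ∧
      s'.HoldsAt 4 5 n (fun k => -q (n - 1 - k)) ∧ t ≤ 100 * n := by
  unfold splitProg
  simp
  refine (Runs.loop (fun s => s.ireg 0 = n ∧ s.ireg 2 ≤ n ∧ s.HoldsAt 0 1 n q ∧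
    s.HoldsAt 2 3 (s.ireg 2) q ∧ s.HoldsAt 4 5 (s.ireg 2) (fun k => -q (n - 1 - k)))
    (fun s => 60 * (n - s.ireg 2)) ?_ ?_).mono ?_
  · rintro s ⟨h0, h1, hA, hB, hC⟩
    simp
    refine ⟨by omega, fun hlt => ⟨by omega, by omega, by omega, by omega,
      ⟨h0, by omega, hA, ?_, ?_⟩, by omega⟩⟩
    · have := hA (s.ireg 2) (by omega)
      exact State.holdsAt_update hB (by simp [this.1]) (by simp [this.2])
    · have := hA (n - 1 - s.ireg 2) (by omega)
      exact State.holdsAt_update hC (by simp [h0, this.1]) (by simp [h0, this.2])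
  · exact ⟨by simpa using h0, by simp, hA, by simp [State.HoldsAt], by simp [State.HoldsAt]⟩
  · rintro s' t ⟨⟨h0, h1, -, hB, hC⟩, hb, ht⟩
    simp at hb ht
    have e : s'.ireg 2 = n := by omega
    rw [e] at hB hC
    exact ⟨h0, hB, hC, by omega⟩

/-- Appends the reflected upper chain to the lower chain. -/
def appendProg : Prog :=
  .iset 2 (.const 0) ;;
  .loop (.ilt (.reg 2) (.reg 3))
    (.rput 0 (.add (.reg 4) (.reg 2)) (.sub (.const 0) (.get 6 (.reg 2))) ;;
     .rput 1 (.add (.reg 4) (.reg 2)) (.sub (.const 0) (.get 7 (.reg 2))) ;;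
     .iset 2 (.add (.reg 2) (.const 1))) ;;
  .iset 0 (.add (.reg 4) (.reg 3))

/-- Writing starts at position `t`, where the last lower vertex stands, and stops before the last
upper vertex: in a closed hull these two duplicate `-l' 0` and `l 0`. -/
theorem runs_appendProg {l l' : ℕ → Plane} {t t' : ℕ} (hW : 10 * n ≤ W) (hn : 1 ≤ n) {s : State}
    (h3 : s.ireg 3 = t') (h4 : s.ireg 4 = t) (ht : t < n) (ht' : t' < n)
    (hl : s.HoldsAt 0 1 (t + 1) l) (hl' : s.HoldsAt 6 7 (t' + 1) l') :
    Runs W appendProg s fun s' c => s'.ireg 0 = t + t' ∧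
      s'.HoldsAt 0 1 (t + t') (joinChains l l' t) ∧ c ≤ 100 * n := by
  unfold appendProg
  simp
  refine (Runs.loop (fun s => s.ireg 3 = t' ∧ s.ireg 4 = t ∧ s.ireg 2 ≤ t' ∧
    s.HoldsAt 0 1 (t + s.ireg 2) (joinChains l l' t) ∧ s.HoldsAt 6 7 (t' + 1) l')
    (fun s => 50 * (n - s.ireg 2)) ?_ ?_).mono ?_
  · rintro s ⟨h3, h4, h2, hl, hl'⟩
    simp
    refine ⟨by omega, fun hlt => ⟨by omega, by omega, ⟨h3, h4, by omega, ?_, hl'⟩, by omega⟩⟩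
    have e := hl' (s.ireg 2) (by omega)
    have e2 : joinChains l l' t (t + s.ireg 2) = -l' (s.ireg 2) := by
      rw [joinChains_of_ge (by omega), Nat.add_sub_cancel_left]
    rw [← add_assoc]
    exact State.holdsAt_update hl (by simp [h4, e2, e.1]) (by simp [h4, e2, e.2])
  · refine ⟨by simpa using h3, by simpa using h4, by simp, ?_, hl'⟩
    intro k hk
    have hk : k < t := by simpa using hk
    rw [show joinChains l l' t k = l k from if_pos hk]
    exact hl k (by omega)
  · rintro s' c ⟨⟨h3, h4, h2, hl, -⟩, hb, hc⟩
    simp at hb hc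
    have e : s'.ireg 2 = t' := by omega
    rw [e] at hl
    exact ⟨by omega, by simp [h3, h4], hl, by omega⟩

/-- Computes the convex hull. -/
def hullProg : Prog :=
  sortProg ;; splitProg ;; scanProg 2 3 0 1 ;; .iset 4 (.reg 3) ;; scanProg 4 5 6 7 ;; appendProg

/-- A monotone sequence of `n` terms with `n` distinct values is injective, so it increases
strictly. -/
theorem exists_sorted_of_key {p : Fin n → Plane} (hp : Function.Injective p)
    {a : ℕ → ℝ ×ₗ ℝ} (ha : MonotoneOn a (Set.Iio n))
    (himg : a '' Set.Iio n = Set.range fun i => toLex (p i 0, p i 1)) :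
    ∃ q : ℕ → Plane, (∀ k, toLex (q k 0, q k 1) = a k) ∧
      (∀ i j, i < j → j < n → LexLt (q i) (q j)) ∧ q '' Set.Iio n = Set.range p := by
  set q : ℕ → Plane := fun k => !₂[(ofLex (a k)).1, (ofLex (a k)).2] with hqdef
  have hqa : ∀ k, toLex (q k 0, q k 1) = a k := by
    intro k
    simp [hqdef]
  have hinj : Set.InjOn a (Set.Iio n) := by
    refine Set.injOn_of_ncard_image_eq ?_ (Set.finite_Iio n)
    rw [himg, ← Set.image_univ, Set.ncard_image_of_injective, Set.ncard_univ, Nat.card_fin,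
      ← Finset.coe_Iio, Set.ncard_coe_finset, Nat.card_Iio]
    intro i j hij
    have := toLex_inj.1 hij
    exact hp (Plane.ext_coord (congrArg Prod.fst this) (congrArg Prod.snd this))
  refine ⟨q, hqa, fun i j hij hj => ?_, ?_⟩
  · rw [LexLt, hqa, hqa]
    refine lt_of_le_of_ne (ha (show i < n by omega) hj hij.le) fun h => ?_
    exact hij.ne (hinj (show i < n by omega) hj h)
  · have hinj' : Function.Injective fun x : Plane => (toLex (x 0, x 1) : ℝ ×ₗ ℝ) := by
      intro x y hxy
      have := toLex_inj.1 hxy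
      exact Plane.ext_coord (congrArg Prod.fst this) (congrArg Prod.snd this)
    refine hinj'.image_injective ?_
    rw [← Set.image_comp, ← Set.range_comp]
    refine Eq.trans (Set.image_congr fun k _ => ?_) himg
    exact hqa k

/-- The lower chain goes to arrays `0`, `1`, where the result is assembled; its length is saved in
register `4`. The second scan works on arrays `4` to `7` and, by `FrameEq`, leaves both intact. -/
theorem runs_hullProg {p : Fin n → Plane} (hn : 2 ≤ n) (hp : Function.Injective p)
    (hW : 10 * n ≤ W) {s : State} (hs : s.Holds p) :
    Runs W hullProg s fun s' t => t ≤ 400 * n * Nat.clog 2 n + 2000 * n ∧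
      ∃ (h : ℕ) (v : Fin h → Plane), IsConvexHullCycle v (Set.range p) ∧ s'.Holds v := by
  have himg : s.key 0 1 '' Set.Iio n = Set.range fun i => toLex (p i 0, p i 1) := by
    ext z
    constructor
    · rintro ⟨k, hk, rfl⟩
      refine ⟨⟨k, hk⟩, ?_⟩
      have := hs.2 ⟨k, hk⟩
      simp only [State.key, ← this.1, ← this.2]
    · rintro ⟨i, rfl⟩
      refine ⟨i, i.2, ?_⟩
      simp only [State.key, hs.2 i]
  unfold hullProg
  rw [runs_seq]
  refine (runs_sortProg hn hW hs.1 himg).mono ?_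
  rintro s₁ t₁ ⟨h0, hmono, himg, ht₁⟩
  obtain ⟨q, hqa, hq, hS⟩ := exists_sorted_of_key hp hmono himg
  have hA : s₁.HoldsAt 0 1 n q := by
    intro k _
    have := toLex_inj.1 (hqa k)
    exact ⟨(congrArg Prod.fst this).symm, (congrArg Prod.snd this).symm⟩
  rw [runs_seq]
  refine (runs_splitProg hW (by omega) h0 hA).mono ?_
  rintro s₂ t₂ ⟨h0, hB, hC, ht₂⟩
  rw [runs_seq]
  refine (runs_scanProg (by norm_num) (by norm_num) (by norm_num) (by norm_num) (by norm_num)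
    (by omega) hq hW h0 hB).mono ?_
  rintro s₃ t₃ ⟨hf, htn, ht₃, l, hl, hst, hlast⟩
  rw [runs_seq, runs_iset]
  refine ⟨by simp; omega, ?_⟩
  rw [runs_seq]
  refine (runs_scanProg (n := n) (q := fun k => -q (n - 1 - k)) (by norm_num) (by norm_num)
    (by norm_num) (by norm_num) (by norm_num) (by omega) (lexLt_reflect hq) hW ?_ ?_).mono ?_
  · simpa [hf.1 0 (by norm_num) (by norm_num)] using h0
  · intro k hk
    simp only [hf.2 4 (by norm_num) (by norm_num), hf.2 5 (by norm_num) (by norm_num)]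
    exact hC k hk
  rintro s₄ t₄ ⟨hf', htn', ht₄, l', hl', hst', hlast'⟩
  refine (runs_appendProg hW (by omega) rfl (t := s₃.ireg 3) ?_ htn htn' (l := l) ?_ hst').mono ?_
  · rw [hf'.1 4 (by norm_num) (by norm_num)]
    simp
  · intro k hk
    rw [hf'.2 0 (by norm_num) (by norm_num), hf'.2 1 (by norm_num) (by norm_num)]
    exact hst k hk
  rintro s₅ t₅ ⟨h0, hv, ht₅⟩
  simp only [IExpr.cost]
  refine ⟨by omega, s₃.ireg 3 + s₄.ireg 3, fun i => joinChains l l' (s₃.ireg 3) i, ?_, h0,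
    fun i => hv i i.2⟩
  rw [← hS]
  exact isConvexHullCycle_joinChains hn hq hl hlast hl' hlast'

end RealRAM

/-! # The main theorem -/

/-- Both `Nat.clog 2 n - 1` and `1` are at most `log n / log 2`, and `2 / log 2 < 3`. -/
theorem Nat.clog_two_le_three_mul_log {n : ℕ} (hn : 2 ≤ n) :
    (Nat.clog 2 n : ℝ) ≤ 3 * Real.log n := by
  have h2 : (0.6931471803 : ℝ) < Real.log 2 := Real.log_two_gt_d9
  have hlog : Real.log 2 ≤ Real.log n :=
    Real.log_le_log (by norm_num) (by exact_mod_cast hn)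
  have h1 : 2 ^ (Nat.clog 2 n - 1) < n := by
    have := Nat.pow_pred_clog_lt_self (b := 2) (by norm_num) (show 1 < n by omega)
    simpa using this
  have hpos : 1 ≤ Nat.clog 2 n := Nat.clog_pos (by norm_num) hn
  have h3 : ((Nat.clog 2 n - 1 : ℕ) : ℝ) * Real.log 2 ≤ Real.log n := by
    rw [← Real.log_pow]
    exact Real.log_le_log (by positivity) (by exact_mod_cast h1.le)
  rw [Nat.cast_sub hpos, Nat.cast_one] at h3
  nlinarith

theorem cast_le_mul_log {n t : ℕ} (hn : 2 ≤ n) (ht : t ≤ 400 * n * Nat.clog 2 n + 3000 * n) :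
    (t : ℝ) ≤ 10000 * (n * Real.log n) := by
  have h1 := Nat.clog_two_le_three_mul_log hn
  have h2 : (0.6931471803 : ℝ) < Real.log 2 := Real.log_two_gt_d9
  have hlog : Real.log 2 ≤ Real.log n :=
    Real.log_le_log (by norm_num) (by exact_mod_cast hn)
  have h3 : (t : ℝ) ≤ 400 * n * Nat.clog 2 n + 3000 * n := by exact_mod_cast ht
  have h4 : (n : ℝ) * Nat.clog 2 n ≤ n * (3 * Real.log n) := by gcongr
  have h5 : (n : ℝ) * 0.69 ≤ n * Real.log n := by gcongr; linarith
  linarith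

theorem mainTheorem12 :
    -- characterization of optimal highways
    (∀ S : Set Plane, S.Finite → S.Nonempty →
      (∃ T : Strip, T.IsSmallestEnclosing S) ∧
      ∀ T : Strip, T.IsSmallestEnclosing S → IsOptimalHighway S T.midline) ∧
    -- computation on a real RAM with words of `O(log n)` bits
    (∃ (hull calipers : RealRAM.Prog) (K : ℕ),
      ∀ (n : ℕ) (p : Fin n → Plane), 2 ≤ n → Function.Injective p →
        -- the convex hull is computed in time `O(n log n)`
        (∀ (W : ℕ) (s : RealRAM.State), K * n ≤ W → s.Holds p →
          ∃ (s' : RealRAM.State) (t : ℕ), RealRAM.Exec W hull s s' t ∧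
            (t : ℝ) ≤ K * (n * Real.log n) ∧
            ∃ (h : ℕ) (v : Fin h → Plane),
              IsConvexHullCycle v (Set.range p) ∧ s'.Holds v) ∧
        -- from a convex hull with `h` vertices, the middle line is computed in time `O(h)`
        (∀ (h : ℕ) (v : Fin h → Plane), IsConvexHullCycle v (Set.range p) →
          ∀ (W : ℕ) (s : RealRAM.State), K * h ≤ W → s.Holds v →
            ∃ (s' : RealRAM.State) (t : ℕ), RealRAM.Exec W calipers s s' t ∧
              t ≤ K * h ∧
              ∃ T : Strip, T.IsSmallestEnclosing (Set.range p) ∧ s'.outputLine = T.midline) ∧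
        -- altogether, an optimal highway is computed in time `O(n log n)`
        (∀ (W : ℕ) (s : RealRAM.State), K * n ≤ W → s.Holds p →
          ∃ (s' : RealRAM.State) (t : ℕ),
            RealRAM.Exec W (RealRAM.Prog.seq hull calipers) s s' t ∧
            (t : ℝ) ≤ K * (n * Real.log n) ∧
            (∃ T : Strip, T.IsSmallestEnclosing (Set.range p) ∧ s'.outputLine = T.midline) ∧
            IsOptimalHighway (Set.range p) s'.outputLine)) := by
  refine ⟨fun S hS hne => ⟨exists_isSmallestEnclosing hS hne,
    fun T hT => hT.isOptimalHighway hS hne⟩, RealRAM.hullProg, RealRAM.calipersProg, 10000, ?_⟩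
  intro n p hn hp
  have hS : (Set.range p).Finite := Set.finite_range p
  have hnt : (Set.range p).Nontrivial :=
    ⟨_, ⟨⟨0, by omega⟩, rfl⟩, _, ⟨⟨1, by omega⟩, rfl⟩, fun h => by simpa using hp h⟩
  have hcard : (Set.range p).ncard = n := by
    rw [← Set.image_univ, Set.ncard_image_of_injective _ hp, Set.ncard_univ, Nat.card_fin]
  refine ⟨fun W s hW hs => ?_, fun h v hv W s hW hs => ?_, fun W s hW hs => ?_⟩
  · obtain ⟨s', t, he, ht, hv⟩ := RealRAM.runs_hullProg (W := W) hn hp (by omega) hs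
    exact ⟨s', t, he, by exact_mod_cast cast_le_mul_log hn (by omega), hv⟩
  · obtain ⟨s', t, he, ht, hT⟩ := RealRAM.runs_calipersProg (W := W) hS hnt hv (by omega) hs
    exact ⟨s', t, he, by omega, hT⟩
  · obtain ⟨s₁, t₁, he₁, ht₁, h, v, hv, hs₁⟩ :=
      RealRAM.runs_hullProg (W := W) hn hp (by omega) hs
    -- The hull has at most `n` vertices, so the linear second part fits the word bound, and its
    -- time is absorbed by the `n log n` bound.
    have hh : h ≤ n := hcard ▸ hv.le_ncard hS
    obtain ⟨s₂, t₂, he₂, ht₂, T, hT, hout⟩ :=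
      RealRAM.runs_calipersProg (W := W) hS hnt hv (by omega) hs₁
    exact ⟨s₂, t₁ + t₂, he₁.seq he₂, by exact_mod_cast cast_le_mul_log hn (by omega), ⟨T, hT, hout⟩,
      hout ▸ hT.isOptimalHighway hS hnt.nonempty⟩
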